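/- **Conventions.** A rooted graph $(\mathcal G,e)$ is a non-oriented graph with vertex set $V$, edge set $E$ and a distinguished vertex $e$; loops and multiple edges are allowed. Let $n(x,y)$ be the number of edges connecting $x$ and $y$. The graph is uniformly locally finite if the degrees $\sum_y n(x,y)$ are bounded; its adjacency matrix is then the bounded operator $A(\mathcal G)$ on $\ell^2(V)$ with $A(\mathcal G)\delta(x)=\sum_y n(x,y)\delta(y)$. Put $\varphi_e(T)=\langle T\delta(e),\delta(e)\rangle$. The spectral distribution of $(\mathcal G,e)$ is the probability measure $\mu$ on $\mathbb R$ with $\int x^n\,d\mu=\varphi_e(A(\mathcal G)^n)$ for all $n\ge 0$; we identify it with the functional $X^n\mapsto\int x^n\,d\mu$ on $\mathbb C[X]$. The $\varphi$-distribution of a random variable $a$ is the functional $X^n\mapsto \varphi(a^n)$ on $\mathbb C[X]$. For a functional $\mu$ on $\mathbb C[X]$ with $\mu(1)=1$ put $\psi_\mu(z)=\sum_{n\ge1}\mu(X^n)z^n$; its first return moments $N_\mu(n)$ are defined by the formal power series $\eta_\mu=\psi_\mu/(1+\psi_\mu)=\sum_{n\ge1}N_\mu(n)z^n$, and $N_a(n)=N_\mu(n)$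 if $\mu$ is the distribution of $a$. Unital subalgebras $\mathcal A_1,\mathcal A_2$ are free with respect to $\varphi$ if $\varphi(a_1\cdots a_m)=0$ whenever $m\ge 1$, $a_k\in\mathcal A_{i_k}$, $\varphi(a_k)=0$ and $i_1\ne i_2\ne\dots\ne i_m$; two random variables are free if the unital algebras that they generate are. $\mu_1\boxtimes\mu_2$ is the distribution of $X_2X_1$ when $X_1,X_2$ are free with distributions $\mu_1,\mu_2$. For rooted graphs $(\mathcal G_1,e_1)$, $(\mathcal G_2,e_2)$ the vertices of the free product $\mathcal G_1*\mathcal G_2$ are the words $x_1x_2\cdots x_m$ ($m\ge0$) with letters in $(V_1\setminus\{e_1\})\sqcup(V_2\setminus\{e_2\})$ and neighbouring letters from different graphs; the root $e$ is the empty word. For $i\in\{1,2\}$ and every word $u$ not beginning with a letter from $V_i$, each edge of $\mathcal G_i$ with ends $x,y$ gives an edge of color $i$ with ends $xu,yu$, where $e_iu$ means $u$. A walk of length $m$ is a sequence $(v_0,\beta_1,v_1,\dots,\beta_m,v_m)$ with $\beta_k$ an edge connecting $v_{k-1}$ and $v_k$. It is alternating if consecutive edges have different colors. A walk of positive length from $v$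 to $v$ is an f-walk if it does not visit $v$ in between. $D_m(e)$ is the set of rooted alternating d-walks of length $m$, that is, alternating walks from $e$ to $e$ of length $m$ whose first edge has color $1$ and which are the concatenation of two f-walks from $e$ to $e$. **Theorem 9.2 (Multiplication Theorem for free independence).** Let $(\mathcal G_1,e_1)$ and $(\mathcal G_2,e_2)$ be uniformly locally finite rooted graphs with spectral distributions $\mu_1$ and $\mu_2$. Then $\mathcal G_1*\mathcal G_2$ is uniformly locally finite, and $A(\mathcal G_1*\mathcal G_2)=S_1+S_2$, where $S_i$ is the adjacency matrix of the subgraph formed by the edges of color $i$ (on all vertices of $\mathcal G_1*\mathcal G_2$). The pair $(S_1-1,S_2-1)$ is free with respect to $\varphi_e$. For every $n\ge1$ the set $D_{2n}(e)$ is finite, and, with $Z=S_2S_1$ and the state $\varphi_e$, $$N_Z(n)=N_{\mu_1\boxtimes\mu_2}(n)=|D_{2n}(e)|.$$ -/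

import Mathlib

open MeasureTheory
open scoped Polynomial PowerSeries lp CompactlySupported

namespace FreeMult

universe u

/-! ### Non-commutative probability -/

/-- The two colors (indices) of the index set `I = {1, 2}`. -/
inductive Color where
  | one
  | two
  deriving DecidableEq

/-- A normalized linear functional on a unital complex algebra; a pair of an algebra and such a
functional is a non-commutative probability space. -/
structure UnitalFunctional (A : Type u) [Ring A] [Algebra ℂ A] where
  toLinearMap : A →ₗ[ℂ] ℂ
  map_one' : toLinearMap 1 = 1

instance (A : Type u) [Ring A] [Algebra ℂ A] :
    CoeFun (UnitalFunctional A) (fun _ => A → ℂ) :=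
  ⟨fun φ => φ.toLinearMap⟩

theorem UnitalFunctional.ext {A : Type u} [Ring A] [Algebra ℂ A] {φ ψ : UnitalFunctional A}
    (h : ∀ a, φ a = ψ a) : φ = ψ := by
  rcases φ with ⟨f, hf⟩
  rcases ψ with ⟨g, hg⟩
  obtain rfl : f = g := LinearMap.ext h
  rfl

/-- Distributions: linear functionals on `ℂ[X]` that send `1` to `1`. -/
abbrev Distribution := UnitalFunctional ℂ[X]

/-- The `φ`-distribution of a random variable `a`: the functional `p ↦ φ (p(a))`. -/
noncomputable def UnitalFunctional.distribution {A : Type u} [Ring A] [Algebra ℂ A]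
    (φ : UnitalFunctional A) (a : A) : Distribution where
  toLinearMap := φ.toLinearMap ∘ₗ (Polynomial.aeval a).toLinearMap
  map_one' := by simpa using φ.map_one'

/-- The moment generating series `ψ_μ(z) = ∑_{n ≥ 1} μ(X ^ n) z ^ n`. -/
noncomputable def momentSeries (μ : Distribution) : ℂ⟦X⟧ :=
  PowerSeries.mk fun n => if n = 0 then 0 else μ (Polynomial.X ^ n)

/-- The first return moment series `η_μ = ψ_μ / (1 + ψ_μ)`. The series `1 + ψ_μ` has constant
coefficient `1`, so it is invertible and `⁻¹` is its genuine inverse. -/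
noncomputable def etaSeries (μ : Distribution) : ℂ⟦X⟧ :=
  momentSeries μ * (1 + momentSeries μ)⁻¹

/-- The `n`-th first return moment `N_μ(n)`, the coefficient of `z ^ n` in `η_μ`. -/
noncomputable def firstReturnMoment (μ : Distribution) (n : ℕ) : ℂ :=
  PowerSeries.coeff n (etaSeries μ)

/-- Free independence of two unital subalgebras with respect to `φ`: the functional vanishes on
`a₁ a₂ ⋯ aₙ` (`n ≥ 1`) whenever each `aₖ` lies in the subalgebra with index `iₖ`, `φ(aₖ) = 0`, and
neighbouring indices are different. A factor is recorded together with its index. -/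
def FreelyIndependent {A : Type u} [Ring A] [Algebra ℂ A] (φ : UnitalFunctional A)
    (B : Color → Subalgebra ℂ A) : Prop :=
  ∀ l : List (Color × A), l ≠ [] → l.IsChain (fun p q => p.1 ≠ q.1) →
    (∀ p ∈ l, p.2 ∈ B p.1 ∧ φ p.2 = 0) → φ (l.map Prod.snd).prod = 0

/-- `φ` is the free product of the distributions `μ₁` and `μ₂`: on the algebra `ℂ⟨X₁, X₂⟩`
of polynomials in two non-commuting variables, `Xᵢ` has distribution `μᵢ`, and `X₁`, `X₂` are
free. -/
def IsFreeProduct (μ : Color → Distribution) (φ : UnitalFunctional (FreeAlgebra ℂ Color)) : Prop :=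
  (∀ i, φ.distribution (FreeAlgebra.ι ℂ i) = μ i) ∧
    FreelyIndependent φ fun i => Algebra.adjoin ℂ {FreeAlgebra.ι ℂ i}

section FreeProductExistence

/-- The action of the variable `Xᵢ` on the free Fock space with basis the words in the letters
`(j, k)`, where `(j, k)` stands for the centered power `Xⱼ ^ (k + 1) - μⱼ(X ^ (k + 1))`. -/
noncomputable def fockBasis (μ : Color → Distribution) (i : Color) :
    List (Color × ℕ) → (List (Color × ℕ) →₀ ℂ)
  | [] => .single [(i, 0)] 1 + .single [] (μ i Polynomial.X)
  | (j, k) :: w =>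
    if j = i then
      .single ((i, k + 1) :: w) 1 + .single w (μ i (Polynomial.X ^ (k + 2)))
        - (μ i (Polynomial.X ^ (k + 1))) • (.single ((i, 0) :: w) 1 + .single w (μ i Polynomial.X))
    else .single ((i, 0) :: (j, k) :: w) 1 + .single ((j, k) :: w) (μ i Polynomial.X)

noncomputable def fockOp (μ : Color → Distribution) (i : Color) :
    Module.End ℂ (List (Color × ℕ) →₀ ℂ) :=
  Finsupp.linearCombination ℂ (fockBasis μ i)

def noHead (i : Color) : Set (List (Color × ℕ)) := {w | ∀ a ∈ w.head?, a.1 ≠ i}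

theorem fockOp_single (μ : Color → Distribution) {i : Color} {w : List (Color × ℕ)}
    (hw : w ∈ noHead i) : fockOp μ i (.single w 1) =
      .single ((i, 0) :: w) 1 + .single w (μ i Polynomial.X) := by
  rcases w with _ | ⟨⟨j, k⟩, w⟩
  · simp [fockOp, fockBasis]
  · have : j ≠ i := hw (j, k) (by simp)
    simp [fockOp, fockBasis, this]

theorem fockOp_cons (μ : Color → Distribution) {i : Color} {w : List (Color × ℕ)}
    (hw : w ∈ noHead i) (k : ℕ) : fockOp μ i (.single ((i, k) :: w) 1) =
      .single ((i, k + 1) :: w) 1 + .single w (μ i (Polynomial.X ^ (k + 2)))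
        - (μ i (Polynomial.X ^ (k + 1))) • fockOp μ i (.single w 1) := by
  rw [fockOp_single μ hw]
  simp [fockOp, fockBasis]

theorem fockOp_pow (μ : Color → Distribution) {i : Color} {w : List (Color × ℕ)}
    (hw : w ∈ noHead i) (n : ℕ) : (fockOp μ i ^ (n + 1)) (.single w 1) =
      .single ((i, n) :: w) 1 + .single w (μ i (Polynomial.X ^ (n + 1))) := by
  induction n with
  | zero => simp [fockOp_single μ hw]
  | succ n ih =>
    rw [pow_succ', Module.End.mul_apply, ih, map_add, fockOp_cons μ hw]
    have : (Finsupp.single w (μ i (Polynomial.X ^ (n + 1))) : List (Color × ℕ) →₀ ℂ) =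
      (μ i (Polynomial.X ^ (n + 1))) • .single w 1 := by simp
    rw [this, map_smul]
    abel

theorem fockOp_aeval (μ : Color → Distribution) {i : Color} {w : List (Color × ℕ)}
    (hw : w ∈ noHead i) (p : ℂ[X]) : ∃ f ∈ Finsupp.supported ℂ ℂ (noHead i)ᶜ,
      Polynomial.aeval (fockOp μ i) p (.single w 1) = f + μ i p • .single w 1 := by
  induction p using Polynomial.induction_on' with
  | add p q hp hq =>
    obtain ⟨f, hf, hf'⟩ := hp
    obtain ⟨g, hg, hg'⟩ := hq
    refine ⟨f + g, add_mem hf hg, ?_⟩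
    rw [map_add, LinearMap.add_apply, hf', hg', map_add, add_smul]
    abel
  | monomial n a =>
    rcases n with _ | n
    · refine ⟨0, zero_mem _, ?_⟩
      have : (μ i).toLinearMap (Polynomial.C a) = a := by
        have h := (μ i).toLinearMap.map_smul a 1
        rw [(μ i).map_one'] at h
        simpa [Polynomial.smul_eq_C_mul] using h
      rw [Polynomial.monomial_zero_left, Polynomial.aeval_C, this]
      simp [Module.algebraMap_end_apply]
    · refine ⟨a • .single ((i, n) :: w) 1, Submodule.smul_mem _ _ ?_, ?_⟩
      · exact Finsupp.single_mem_supported ℂ _ (by simp [noHead])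
      · rw [Polynomial.aeval_monomial, Module.End.mul_apply, fockOp_pow μ hw,
          ← Polynomial.C_mul_X_pow_eq_monomial, ← Polynomial.smul_eq_C_mul, map_smul,
          Module.algebraMap_end_apply, smul_add]
        simp

noncomputable def fockRep (μ : Color → Distribution) :
    FreeAlgebra ℂ Color →ₐ[ℂ] Module.End ℂ (List (Color × ℕ) →₀ ℂ) :=
  FreeAlgebra.lift ℂ (fockOp μ)

noncomputable def fockState (μ : Color → Distribution) :
    UnitalFunctional (FreeAlgebra ℂ Color) where
  toLinearMap := Finsupp.lapply [] ∘ₗ LinearMap.applyₗ (.single [] 1) ∘ₗ (fockRep μ).toLinearMap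
  map_one' := by simp

theorem fockState_apply (μ : Color → Distribution) (a : FreeAlgebra ℂ Color) :
    fockState μ a = fockRep μ a (.single [] 1) [] := rfl

theorem fockRep_aeval (μ : Color → Distribution) (i : Color) (p : ℂ[X]) :
    fockRep μ (Polynomial.aeval (FreeAlgebra.ι ℂ i) p) = Polynomial.aeval (fockOp μ i) p := by
  rw [← Polynomial.aeval_algHom_apply]
  simp [fockRep]

theorem fockState_aeval (μ : Color → Distribution) (i : Color) (p : ℂ[X]) :
    fockState μ (Polynomial.aeval (FreeAlgebra.ι ℂ i) p) = μ i p := by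
  obtain ⟨f, hf, h⟩ := fockOp_aeval μ (i := i) (w := []) (by simp [noHead]) p
  have h0 : f [] = 0 := by
    by_contra h0
    exact hf (by simpa using h0) (by simp [noHead])
  rw [fockState_apply, fockRep_aeval, h]
  simp [h0]

theorem fockRep_chain (μ : Color → Distribution) (i : Color)
    (l : List (Color × FreeAlgebra ℂ Color)) (hl : (l.map Prod.fst).head? ≠ some i)
    (hc : l.IsChain (fun p q => p.1 ≠ q.1))
    (h : ∀ p ∈ l, p.2 ∈ Algebra.adjoin ℂ {FreeAlgebra.ι ℂ p.1} ∧ fockState μ p.2 = 0) :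
    fockRep μ (l.map Prod.snd).prod (.single [] 1) ∈ Finsupp.supported ℂ ℂ (noHead i) ∧
      (l ≠ [] → fockState μ (l.map Prod.snd).prod = 0) := by
  induction l generalizing i with
  | nil =>
    refine ⟨?_, fun h => absurd rfl h⟩
    simpa using Finsupp.single_mem_supported ℂ (1 : ℂ) (a := ([] : List (Color × ℕ)))
      (s := noHead i) (by simp [noHead])
  | cons q l ih =>
    obtain ⟨j, a⟩ := q
    have hji : j ≠ i := by simpa using hl
    have hj : (l.map Prod.fst).head? ≠ some j := by
      rcases l with _ | ⟨r, l⟩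
      · simp
      · have := (List.isChain_cons_cons.1 hc).1
        simpa using this.symm
    obtain ⟨h1, -⟩ := ih j hj hc.tail (fun p hp => h p (List.mem_cons_of_mem _ hp))
    obtain ⟨ha, ha0⟩ := h (j, a) (by simp)
    rw [Algebra.adjoin_singleton_eq_range_aeval] at ha
    obtain ⟨p, hpa⟩ := ha
    replace hpa : Polynomial.aeval (FreeAlgebra.ι ℂ j) p = a := hpa
    subst hpa
    have hp : μ j p = 0 := by rw [← fockState_aeval μ j p]; exact ha0
    have key : ∀ f ∈ Finsupp.supported ℂ ℂ (noHead j),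
        Polynomial.aeval (fockOp μ j) p f ∈ Finsupp.supported ℂ ℂ (noHead j)ᶜ := by
      intro f hf
      rw [Finsupp.supported_eq_span_single] at hf
      refine Submodule.span_induction ?_ (by simp) (fun x y _ _ hx hy => ?_)
        (fun c x _ hx => ?_) hf
      · rintro _ ⟨w, hw, rfl⟩
        obtain ⟨f, hf, h⟩ := fockOp_aeval μ hw p
        rw [h, hp, zero_smul, add_zero]
        exact hf
      · rw [map_add]; exact add_mem hx hy
      · rw [map_smul]; exact Submodule.smul_mem _ _ hx
    have h2 := key _ h1
    have h3 : fockRep μ ((((j, Polynomial.aeval (FreeAlgebra.ι ℂ j) p) : Color × _) :: l).map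
        Prod.snd).prod (.single [] 1) ∈ Finsupp.supported ℂ ℂ (noHead j)ᶜ := by
      rw [List.map_cons, List.prod_cons, map_mul, Module.End.mul_apply, fockRep_aeval]
      exact h2
    refine ⟨Finsupp.supported_mono ?_ h3, fun _ => ?_⟩
    · intro w hw
      simp only [noHead, Set.mem_compl_iff, Set.mem_ofPred_eq, not_forall] at hw ⊢
      obtain ⟨b, hb, hbj⟩ := hw
      intro c hc
      rw [Option.mem_def] at hb hc
      rw [hb] at hc
      obtain rfl := Option.some.inj hc
      rw [not_not.1 hbj]
      exact hji
    · by_contra h0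
      exact h3 (by simpa [fockState_apply] using h0) (by simp [noHead])

theorem exists_isFreeProduct (μ : Color → Distribution) : ∃ φ, IsFreeProduct μ φ := by
  refine ⟨fockState μ, fun i => ?_, fun l hl hc h => ?_⟩
  · exact UnitalFunctional.ext fun p => fockState_aeval μ i p
  · obtain ⟨i, hi⟩ : ∃ i, (l.map Prod.fst).head? ≠ some i := by
      rcases h : (l.map Prod.fst).head? with _ | c
      · exact ⟨.one, by simp⟩
      · rcases c with _ | _
        · exact ⟨.two, by simp⟩
        · exact ⟨.one, by simp⟩
    exact (fockRep_chain μ i l hi hc h).2 hl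

/-- The product of centered powers `Xᵢ ^ (k + 1) - μᵢ(X ^ (k + 1))` along a word of pairs `(i, k)`. -/
noncomputable def centeredWord (μ : Color → Distribution) (w : List (Color × ℕ)) :
    FreeAlgebra ℂ Color :=
  (w.map fun p => FreeAlgebra.ι ℂ p.1 ^ (p.2 + 1) -
    algebraMap ℂ _ (μ p.1 (Polynomial.X ^ (p.2 + 1)))).prod

theorem span_centeredWord (μ : Color → Distribution) :
    Submodule.span ℂ (centeredWord μ '' {w | w.IsChain (fun p q => p.1 ≠ q.1)}) = ⊤ := by
  set M := Submodule.span ℂ (centeredWord μ '' {w | w.IsChain (fun p q => p.1 ≠ q.1)}) with hM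
  have hmem : ∀ w : List (Color × ℕ), w.IsChain (fun p q => p.1 ≠ q.1) → centeredWord μ w ∈ M :=
    fun w hw => Submodule.subset_span ⟨w, hw, rfl⟩
  have hfree : ∀ i (w : List (Color × ℕ)), w.IsChain (fun p q => p.1 ≠ q.1) →
      (∀ a ∈ w.head?, a.1 ≠ i) → FreeAlgebra.ι ℂ i * centeredWord μ w ∈ M := by
    intro i w hw hi
    have hw' : ((i, 0) :: w).IsChain (fun p q => p.1 ≠ q.1) := by
      rcases w with _ | ⟨a, w⟩
      · simp
      · exact List.isChain_cons_cons.2 ⟨(hi a (by simp)).symm, hw⟩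
    have : FreeAlgebra.ι ℂ i * centeredWord μ w =
        centeredWord μ ((i, 0) :: w) + μ i Polynomial.X • centeredWord μ w := by
      simp [centeredWord, Algebra.smul_def, sub_mul]
    rw [this]
    exact add_mem (hmem _ hw') (M.smul_mem _ (hmem _ hw))
  have hι : ∀ i, ∀ x ∈ M, FreeAlgebra.ι ℂ i * x ∈ M := by
    intro i x hx
    refine Submodule.span_induction ?_ (by simp) (fun x y _ _ hx hy => ?_)
      (fun c x _ hx => ?_) hx
    · rintro _ ⟨w, hw, rfl⟩
      by_cases hi : ∀ a ∈ w.head?, a.1 ≠ i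
      · exact hfree i w hw hi
      · rcases w with _ | ⟨⟨j, k⟩, w⟩
        · simp at hi
        · have hji : j = i := by simpa using hi
          subst hji
          have hw' : ((j, k + 1) :: w).IsChain (fun p q => p.1 ≠ q.1) := by
            rcases w with _ | ⟨a, w⟩
            · simp
            · exact List.isChain_cons_cons.2 (List.isChain_cons_cons.1 hw)
          have hj : ∀ a ∈ w.head?, a.1 ≠ j := by
            rcases w with _ | ⟨a, w⟩
            · simp
            · simpa using (List.isChain_cons_cons.1 hw).1.symm
          have : FreeAlgebra.ι ℂ j * centeredWord μ ((j, k) :: w) =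
              centeredWord μ ((j, k + 1) :: w) +
                μ j (Polynomial.X ^ (k + 2)) • centeredWord μ w -
                μ j (Polynomial.X ^ (k + 1)) • (FreeAlgebra.ι ℂ j * centeredWord μ w) := by
            simp only [centeredWord, List.map_cons, List.prod_cons, Algebra.algebraMap_eq_smul_one]
            simp only [sub_mul, mul_sub, smul_mul_assoc, mul_smul_comm, one_mul,
              pow_succ' _ (k + 1), mul_assoc]
            abel
          rw [this]
          exact sub_mem (add_mem (hmem _ hw') (M.smul_mem _ (hmem _ hw.tail)))
            (M.smul_mem _ (hfree j w hw.tail hj))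
    · rw [mul_add]; exact add_mem hx hy
    · rw [mul_smul_comm]; exact M.smul_mem _ hx
  have hall : ∀ a : FreeAlgebra ℂ Color, ∀ x ∈ M, a * x ∈ M := by
    intro a
    induction a using FreeAlgebra.induction with
    | grade0 r => intro x hx; rw [← Algebra.smul_def]; exact M.smul_mem _ hx
    | grade1 i => exact hι i
    | mul a b ha hb => intro x hx; rw [mul_assoc]; exact ha _ (hb _ hx)
    | add a b ha hb => intro x hx; rw [add_mul]; exact add_mem (ha _ hx) (hb _ hx)
  refine Submodule.eq_top_iff'.2 fun a => ?_
  have h1 : (1 : FreeAlgebra ℂ Color) ∈ M := by simpa [centeredWord] using hmem [] (by simp)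
  simpa using hall a 1 h1

theorem IsFreeProduct.apply_centeredWord {μ : Color → Distribution}
    {φ : UnitalFunctional (FreeAlgebra ℂ Color)} (hφ : IsFreeProduct μ φ) {w : List (Color × ℕ)}
    (hw : w.IsChain (fun p q => p.1 ≠ q.1)) (h0 : w ≠ []) : φ (centeredWord μ w) = 0 := by
  have h := hφ.2 (w.map fun p => (p.1, FreeAlgebra.ι ℂ p.1 ^ (p.2 + 1) -
    algebraMap ℂ _ (μ p.1 (Polynomial.X ^ (p.2 + 1))))) (by simpa using h0)
    ((List.isChain_map _).2 hw) ?_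
  · rwa [List.map_map] at h
  · intro p hp
    obtain ⟨⟨i, k⟩, -, rfl⟩ := List.mem_map.1 hp
    refine ⟨sub_mem (pow_mem (Algebra.self_mem_adjoin_singleton ℂ _) _)
      (Subalgebra.algebraMap_mem _ _), ?_⟩
    have hd : φ (FreeAlgebra.ι ℂ i ^ (k + 1)) = μ i (Polynomial.X ^ (k + 1)) := by
      rw [← hφ.1 i]
      simp [UnitalFunctional.distribution]
    simp only [map_sub, hd, Algebra.algebraMap_eq_smul_one, map_smul, φ.map_one']
    simp

end FreeProductExistence

/-- The free product of two distributions exists and is unique. -/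
theorem existsUnique_isFreeProduct (μ : Color → Distribution) : ∃! φ, IsFreeProduct μ φ := by
  obtain ⟨φ, hφ⟩ := exists_isFreeProduct μ
  refine ⟨φ, hφ, fun ψ hψ => UnitalFunctional.ext fun a => ?_⟩
  have ha : a ∈ Submodule.span ℂ (centeredWord μ '' {w | w.IsChain (fun p q => p.1 ≠ q.1)}) := by
    rw [span_centeredWord]; trivial
  refine LinearMap.eqOn_span (f := ψ.toLinearMap) (g := φ.toLinearMap) ?_ ha
  rintro _ ⟨w, hw, rfl⟩
  by_cases h0 : w = []
  · subst h0
    simpa [centeredWord] using ψ.map_one'.trans φ.map_one'.symm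
  · exact (hψ.apply_centeredWord hw h0).trans (hφ.apply_centeredWord hw h0).symm

/-- The functional on `ℂ⟨X₁, X₂⟩` for which `X₁`, `X₂` are free with distributions `μ₁`, `μ₂`. -/
noncomputable def freeProductFunctional (μ : Color → Distribution) :
    UnitalFunctional (FreeAlgebra ℂ Color) :=
  (exists_isFreeProduct μ).choose

theorem isFreeProduct_freeProductFunctional (μ : Color → Distribution) :
    IsFreeProduct μ (freeProductFunctional μ) :=
  (exists_isFreeProduct μ).choose_spec

/-- The free multiplicative convolution `μ₁ ⊠ μ₂`: the distribution of `X₂ X₁`, where `X₁` and `X₂`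
are free random variables with distributions `μ₁` and `μ₂`. -/
noncomputable def freeMulConv (μ₁ μ₂ : Distribution) : Distribution :=
  (freeProductFunctional fun | .one => μ₁ | .two => μ₂).distribution
    (FreeAlgebra.ι ℂ Color.two * FreeAlgebra.ι ℂ Color.one)

/-- A bounded self-adjoint operator has a spectral distribution in every vector state. -/
theorem exists_spectralMeasure {H : Type u} [NormedAddCommGroup H] [InnerProductSpace ℂ H]
    [CompleteSpace H] (T : H →L[ℂ] H) (hsa : IsSelfAdjoint T) (ξ : H) (hξ : ‖ξ‖ = 1) :
    ∃ μ : ProbabilityMeasure ℝ, ∀ n : ℕ, Integrable (fun x : ℝ => x ^ n) (μ : Measure ℝ) ∧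
      inner ℂ ξ ((T ^ n) ξ) = ((∫ x : ℝ, x ^ n ∂(μ : Measure ℝ) : ℝ) : ℂ) := by
  let Λ : C_c(spectrum ℝ T, ℝ) →ₗ[ℝ] ℝ :=
    { toFun := fun f => (inner ℂ ξ (cfcHom hsa (f : C(spectrum ℝ T, ℝ)) ξ)).re
      map_add' := fun f g => by
        have : ((f + g : C_c(spectrum ℝ T, ℝ)) : C(spectrum ℝ T, ℝ)) = f + g := rfl
        rw [this, map_add]
        simp
      map_smul' := fun c f => by
        have : ((c • f : C_c(spectrum ℝ T, ℝ)) : C(spectrum ℝ T, ℝ)) = c • f := rfl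
        rw [this, map_smul, smul_apply, inner_smul_right_eq_smul]
        simp }
  have hΛ : ∀ f, 0 ≤ f → 0 ≤ Λ f := by
    intro f hf
    have h1 : 0 ≤ cfcHom hsa (f : C(spectrum ℝ T, ℝ)) := (cfcHom_nonneg_iff hsa).2 hf
    rw [ContinuousLinearMap.nonneg_iff_isPositive] at h1
    exact h1.re_inner_nonneg_right ξ
  let Λ' : C_c(spectrum ℝ T, ℝ) →ₚ[ℝ] ℝ := PositiveLinearMap.mk₀ Λ hΛ
  have hrep := RealRMK.integral_rieszMeasure Λ'
  set ν := RealRMK.rieszMeasure Λ' with hν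
  have hmom : ∀ n : ℕ, ∫ x : spectrum ℝ T, (x : ℝ) ^ n ∂ν = (inner ℂ ξ ((T ^ n) ξ)).re := by
    intro n
    let g : C(spectrum ℝ T, ℝ) := (ContinuousMap.restrict (spectrum ℝ T) (.id ℝ)) ^ n
    have h1 := hrep (CompactlySupportedContinuousMap.continuousMapEquiv g)
    have h2 : cfcHom hsa g = T ^ n := by
      rw [map_pow, cfcHom_id]
    rw [← h2]
    exact h1
  have hreal : ∀ n : ℕ, inner ℂ ξ ((T ^ n) ξ) = (((inner ℂ ξ ((T ^ n) ξ)).re : ℝ) : ℂ) := by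
    intro n
    refine (Complex.conj_eq_iff_re.1 ?_).symm
    rw [inner_conj_symm, ← ContinuousLinearMap.adjoint_inner_right]
    rw [ContinuousLinearMap.isSelfAdjoint_iff'.1 (hsa.pow n)]
  have hemb : MeasurableEmbedding (Subtype.val : spectrum ℝ T → ℝ) :=
    MeasurableEmbedding.subtype_coe (spectrum.isCompact T).isClosed.measurableSet
  have hprob : IsProbabilityMeasure ν := by
    have h := hmom 0
    have h1 : (inner ℂ ξ ((T ^ 0) ξ)).re = 1 := by
      rw [pow_zero, one_apply_eq_self, inner_self_eq_norm_sq_to_K, hξ]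
      simp
    rw [h1] at h
    simp only [pow_zero, integral_const, smul_eq_mul, mul_one] at h
    rw [isProbabilityMeasure_iff]
    rw [Measure.real, ENNReal.toReal_eq_one_iff] at h
    exact h
  refine ⟨⟨ν.map Subtype.val, Measure.isProbabilityMeasure_map
    hemb.measurable.aemeasurable⟩, fun n => ⟨?_, ?_⟩⟩
  · change Integrable (fun x : ℝ => x ^ n) (ν.map Subtype.val)
    rw [hemb.integrable_map_iff]
    have hc : Continuous ((fun x : ℝ => x ^ n) ∘ (Subtype.val : spectrum ℝ T → ℝ)) := by
      fun_prop
    exact hc.integrable_of_hasCompactSupport (HasCompactSupport.of_compactSpace _)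
  · change _ = ((∫ x : ℝ, x ^ n ∂(ν.map Subtype.val) : ℝ) : ℂ)
    rw [hemb.integral_map, hmom n]
    exact hreal n

/-- The distribution (moment functional) `ℂ[X] → ℂ`, `X ^ n ↦ ∫ x ^ n dμ`, of a probability measure
on the line; it is meant for measures with finite moments. -/
noncomputable def measureDistribution (μ : ProbabilityMeasure ℝ) : Distribution where
  toLinearMap := (Polynomial.basisMonomials ℂ).constr ℂ
    fun n => ((∫ x : ℝ, x ^ n ∂(μ : Measure ℝ) : ℝ) : ℂ)
  map_one' := by
    have h : (1 : ℂ[X]) = Polynomial.basisMonomials ℂ 0 := by simp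
    rw [h, Module.Basis.constr_basis]
    simp

/-! ### Rooted graphs and their adjacency operators -/

/-- A rooted non-oriented graph with vertex set `V` and edge set `E`; loops and multiple edges are
allowed. `ends β` is the unordered pair of end vertices of the edge `β`. -/
structure RootedGraph where
  V : Type u
  E : Type u
  ends : E → Sym2 V
  root : V

namespace RootedGraph

/-- The number `n(x, y)` of edges connecting `x` and `y`. -/
noncomputable def edgeCount (G : RootedGraph.{u}) (x y : G.V) : ℕ :=
  Nat.card {β : G.E // G.ends β = s(x, y)}

/-- The degree of `x`: the number `∑_y n(x, y)` of edges incident on `x`, a loop being counted once. -/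
noncomputable def degree (G : RootedGraph.{u}) (x : G.V) : ℕ∞ :=
  {β : G.E | x ∈ G.ends β}.encard

/-- The degrees of the vertices are bounded. -/
def UniformlyLocallyFinite (G : RootedGraph.{u}) : Prop :=
  ∃ K : ℕ, ∀ x, G.degree x ≤ K

open Classical in
/-- The vector `δ(x)` of the standard orthonormal basis of `ℓ²(V)`. -/
noncomputable def delta (G : RootedGraph.{u}) (x : G.V) : ℓ²(G.V, ℂ) :=
  lp.single 2 x (1 : ℂ)

/-- `T δ(x) = ∑_y n(x, y) δ(y)` for every vertex `x`. -/
def IsAdjacencyOperator (G : RootedGraph.{u}) (T : ℓ²(G.V, ℂ) →L[ℂ] ℓ²(G.V, ℂ)) : Prop :=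
  ∀ x y, T (G.delta x) y = G.edgeCount x y

open Classical in
/-- The adjacency matrix `A(𝒢)` as the bounded operator on `ℓ²(V)` with
`A δ(x) = ∑_y n(x, y) δ(y)`. It is used for uniformly locally finite graphs only, for which it
exists by `isAdjacencyOperator_adjacencyOperator` below (otherwise the value is `0`). -/
noncomputable def adjacencyOperator (G : RootedGraph.{u}) : ℓ²(G.V, ℂ) →L[ℂ] ℓ²(G.V, ℂ) :=
  if h : ∃ T, G.IsAdjacencyOperator T then h.choose else 0

theorem edgeCount_comm (G : RootedGraph.{u}) (x y : G.V) :
    G.edgeCount x y = G.edgeCount y x := by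
  rw [edgeCount, edgeCount, Sym2.eq_swap]

theorem sum_edgeCount_le (G : RootedGraph.{u}) {K : ℕ} (hK : ∀ x, G.degree x ≤ K) (x : G.V)
    (t : Finset G.V) : ∑ y ∈ t, G.edgeCount x y ≤ K := by
  classical
  have hfin : {β : G.E | x ∈ G.ends β}.Finite :=
    Set.finite_of_encard_le_coe (hK x)
  set F := hfin.toFinset with hF
  have hcard : F.card ≤ K := by
    have := hK x
    rw [degree, hfin.encard_eq_coe_toFinset_card] at this
    exact_mod_cast this
  have h1 : ∀ y, G.edgeCount x y = (F.filter fun β => G.ends β = s(x, y)).card := by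
    intro y
    rw [edgeCount]
    refine Nat.subtype_card _ fun β => ?_
    simp only [hF, Finset.mem_filter, Set.Finite.mem_toFinset, Set.mem_ofPred_eq]
    exact ⟨fun h => h.2, fun h => ⟨by rw [h]; exact Sym2.mem_mk_left x y, h⟩⟩
  calc ∑ y ∈ t, G.edgeCount x y = ∑ y ∈ t, (F.filter fun β => G.ends β = s(x, y)).card :=
        Finset.sum_congr rfl fun y _ => h1 y
    _ = (t.biUnion fun y => F.filter fun β => G.ends β = s(x, y)).card := by
        rw [Finset.card_biUnion]
        intro y _ z _ hyz
        rw [Function.onFun, Finset.disjoint_left]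
        intro β hβ hβ'
        rw [Finset.mem_filter] at hβ hβ'
        have := hβ.2.symm.trans hβ'.2
        exact hyz (Sym2.congr_right.1 this)
    _ ≤ F.card := Finset.card_le_card (by
        intro β hβ
        simp only [Finset.mem_biUnion, Finset.mem_filter] at hβ
        exact hβ.choose_spec.2.1)
    _ ≤ K := hcard

theorem exists_isAdjacencyOperator (G : RootedGraph.{u}) (hG : G.UniformlyLocallyFinite) :
    ∃ T, G.IsAdjacencyOperator T := by
  classical
  obtain ⟨K, hK⟩ := hG
  have hsum := G.sum_edgeCount_le hK
  have hN : ∀ x, {y | G.edgeCount x y ≠ 0}.Finite := by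
    intro x
    by_contra hinf
    obtain ⟨t, ht, htc⟩ := Set.Infinite.exists_subset_card_eq hinf (K + 1)
    have h1 := hsum x t
    have h2 : t.card • 1 ≤ ∑ y ∈ t, G.edgeCount x y :=
      Finset.card_nsmul_le_sum _ _ _ fun y hy => Nat.one_le_iff_ne_zero.2 (ht hy)
    simp at h2
    omega
  let N : G.V → Finset G.V := fun x => (hN x).toFinset
  have hNmem : ∀ x y, y ∉ N x → G.edgeCount x y = 0 := by
    intro x y h
    simpa [N] using h
  let S : (G.V → ℂ) → G.V → ℂ := fun f x => ∑ y ∈ N x, (G.edgeCount x y : ℂ) * f y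
  have bound : ∀ (f : ℓ²(G.V, ℂ)) (s : Finset G.V),
      ∑ x ∈ s, ‖S f x‖ ^ 2 ≤ (K * ‖f‖) ^ 2 := by
    intro f s
    let t := s.biUnion N
    have hf2 : ∑ y ∈ t, ‖f y‖ ^ 2 ≤ ‖f‖ ^ 2 := by
      have := lp.sum_rpow_le_norm_rpow (p := 2) (by norm_num) f t
      simpa using this
    have h1 : ∀ x ∈ s, ‖S f x‖ ^ 2 ≤ K * ∑ y ∈ t, (G.edgeCount x y : ℝ) * ‖f y‖ ^ 2 := by
      intro x hx
      have hsub : N x ⊆ t := Finset.subset_biUnion_of_mem N hx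
      have e1 : ‖S f x‖ ≤ ∑ y ∈ t, (G.edgeCount x y : ℝ) * ‖f y‖ := by
        refine (norm_sum_le _ _).trans ?_
        simp only [norm_mul, Complex.norm_natCast]
        exact Finset.sum_le_sum_of_subset_of_nonneg hsub fun _ _ _ => by positivity
      have e2 : (∑ y ∈ t, (G.edgeCount x y : ℝ) * ‖f y‖) ^ 2 ≤
          (∑ y ∈ t, (G.edgeCount x y : ℝ)) * ∑ y ∈ t, (G.edgeCount x y : ℝ) * ‖f y‖ ^ 2 :=
        Finset.sum_sq_le_sum_mul_sum_of_sq_le_mul _ (fun _ _ => by positivity)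
          (fun _ _ => by positivity) fun _ _ => le_of_eq (by ring)
      calc ‖S f x‖ ^ 2 ≤ (∑ y ∈ t, (G.edgeCount x y : ℝ) * ‖f y‖) ^ 2 := by gcongr
        _ ≤ _ := e2
        _ ≤ _ := by
          gcongr
          exact_mod_cast hsum x t
    calc ∑ x ∈ s, ‖S f x‖ ^ 2
        ≤ ∑ x ∈ s, K * ∑ y ∈ t, (G.edgeCount x y : ℝ) * ‖f y‖ ^ 2 := Finset.sum_le_sum h1
      _ = K * ∑ y ∈ t, (∑ x ∈ s, (G.edgeCount x y : ℝ)) * ‖f y‖ ^ 2 := by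
        rw [← Finset.mul_sum, Finset.sum_comm]
        simp_rw [Finset.sum_mul]
      _ ≤ K * ∑ y ∈ t, (K : ℝ) * ‖f y‖ ^ 2 := by
        gcongr with y hy
        simp_rw [G.edgeCount_comm _ y]
        exact_mod_cast hsum y s
      _ ≤ (K * ‖f‖) ^ 2 := by
        rw [← Finset.mul_sum, mul_pow]
        nlinarith [hf2, (by positivity : (0 : ℝ) ≤ (K : ℝ) ^ 2)]
  have bound' : ∀ (f : ℓ²(G.V, ℂ)) (s : Finset G.V),
      ∑ x ∈ s, ‖S f x‖ ^ (2 : ENNReal).toReal ≤ (K * ‖f‖) ^ (2 : ENNReal).toReal := by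
    intro f s
    simpa using bound f s
  let L : ℓ²(G.V, ℂ) →ₗ[ℂ] ℓ²(G.V, ℂ) :=
    { toFun := fun f => ⟨S f, memℓp_gen' (bound' f)⟩
      map_add' := fun f g => by
        ext x
        change S _ x = S f x + S g x
        simp [S, mul_add, Finset.sum_add_distrib]
      map_smul' := fun c f => by
        ext x
        change S _ x = c • S f x
        simp [S, Finset.mul_sum, mul_left_comm] }
  refine ⟨L.mkContinuous K fun f => ?_, fun x y => ?_⟩
  · exact lp.norm_le_of_forall_sum_le (by norm_num) (by positivity) (bound' f)
  · have : L (G.delta x) y = ∑ z ∈ N y, (G.edgeCount y z : ℂ) * G.delta x z := rfl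
    rw [LinearMap.mkContinuous_apply, this, G.edgeCount_comm x y]
    simp only [delta, lp.single_apply, Pi.single_apply, mul_ite, mul_one, mul_zero,
      Finset.sum_ite_eq']
    split_ifs with h
    · rfl
    · rw [hNmem y x h, Nat.cast_zero]

theorem isAdjacencyOperator_adjacencyOperator (G : RootedGraph.{u})
    (hG : G.UniformlyLocallyFinite) : G.IsAdjacencyOperator G.adjacencyOperator := by
  have h := G.exists_isAdjacencyOperator hG
  rw [adjacencyOperator, dif_pos h]
  exact h.choose_spec

theorem norm_delta (G : RootedGraph.{u}) (x : G.V) : ‖G.delta x‖ = 1 := by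
  classical
  rw [delta, lp.norm_single (by norm_num)]
  simp

theorem inner_delta_left (G : RootedGraph.{u}) (x : G.V) (f : ℓ²(G.V, ℂ)) :
    inner ℂ (G.delta x) f = f x := by
  classical
  rw [delta, lp.inner_single_left]
  simp

/-- The state `φ_e(T) = ⟨T δ(e), δ(e)⟩` associated with the root, on the bounded operators. -/
noncomputable def rootState (G : RootedGraph.{u}) :
    UnitalFunctional (ℓ²(G.V, ℂ) →L[ℂ] ℓ²(G.V, ℂ)) where
  toLinearMap :=
    { toFun := fun T => inner ℂ (G.delta G.root) (T (G.delta G.root))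
      map_add' := fun S T => by simp
      map_smul' := fun c T => by simp }
  map_one' := by
    change inner ℂ (G.delta G.root) (G.delta G.root) = 1
    rw [inner_self_eq_norm_sq_to_K, norm_delta]
    simp

/-- `μ` is the spectral distribution of the rooted graph: its moments are those of the
adjacency operator in the state `φ_e`. -/
def IsSpectralDistribution (G : RootedGraph.{u}) (μ : ProbabilityMeasure ℝ) : Prop :=
  ∀ n : ℕ, Integrable (fun x : ℝ => x ^ n) (μ : Measure ℝ) ∧
    G.rootState (G.adjacencyOperator ^ n) = ((∫ x : ℝ, x ^ n ∂(μ : Measure ℝ) : ℝ) : ℂ)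

theorem isSelfAdjoint_adjacencyOperator (G : RootedGraph.{u}) :
    IsSelfAdjoint G.adjacencyOperator := by
  classical
  by_cases h : ∃ T, G.IsAdjacencyOperator T
  · have hT : G.IsAdjacencyOperator G.adjacencyOperator := by
      rw [adjacencyOperator, dif_pos h]
      exact h.choose_spec
    set T := G.adjacencyOperator
    have hd : ∀ x, T (G.delta x) = ContinuousLinearMap.adjoint T (G.delta x) := by
      intro x
      ext y
      rw [← inner_delta_left, ← inner_delta_left, ContinuousLinearMap.adjoint_inner_right,
        inner_delta_left, ← inner_conj_symm, inner_delta_left, hT, hT, G.edgeCount_comm]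
      simp
    rw [ContinuousLinearMap.isSelfAdjoint_iff']
    refine ContinuousLinearMap.ext fun f => ?_
    have hf := lp.hasSum_single (p := 2) (by norm_num) f
    have hs : ∀ x, lp.single 2 x (f x) = f x • G.delta x := by
      intro x
      rw [delta, ← lp.single_smul]
      simp
    refine (hf.mapL (ContinuousLinearMap.adjoint T)).unique ?_
    convert hf.mapL T using 2 with x
    rw [hs, map_smul, map_smul, hd]
  · rw [adjacencyOperator, dif_neg h]
    exact IsSelfAdjoint.zero _

theorem exists_isSpectralDistribution (G : RootedGraph.{u}) :
    ∃ μ : ProbabilityMeasure ℝ, G.IsSpectralDistribution μ :=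
  exists_spectralMeasure G.adjacencyOperator G.isSelfAdjoint_adjacencyOperator
    (G.delta G.root) (G.norm_delta G.root)

/-- The spectral distribution of the rooted graph. -/
noncomputable def spectralDistribution (G : RootedGraph.{u}) : ProbabilityMeasure ℝ :=
  G.exists_isSpectralDistribution.choose

theorem isSpectralDistribution_spectralDistribution (G : RootedGraph.{u}) :
    G.IsSpectralDistribution G.spectralDistribution :=
  G.exists_isSpectralDistribution.choose_spec

/-- The graph with the same vertices and root whose edges are the edges of color `i`. -/
def monochromatic (G : RootedGraph.{u}) (c : G.E → Color) (i : Color) : RootedGraph.{u} where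
  V := G.V
  E := {β : G.E // c β = i}
  ends := fun β => G.ends β
  root := G.root

/-! ### Walks -/

/-- A walk `(v₀, β₁, v₁, …, βₙ, vₙ)` of length `n`. -/
structure Walk (G : RootedGraph.{u}) (n : ℕ) where
  vert : Fin (n + 1) → G.V
  edge : Fin n → G.E
  ends_edge : ∀ i : Fin n, G.ends (edge i) = s(vert i.castSucc, vert i.succ)

/-- The subwalk of `w` from time `i` to time `j` (with `i < j`) is an f-walk from `v` to `v`: it
starts and ends at `v` and does not visit `v` in between. -/
def Walk.IsFSubwalk {G : RootedGraph.{u}} {n : ℕ} (w : G.Walk n) (v : G.V)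
    (i j : Fin (n + 1)) : Prop :=
  i < j ∧ w.vert i = v ∧ w.vert j = v ∧ ∀ k, i < k → k < j → w.vert k ≠ v

/-- The colors of consecutive edges of the walk are different. -/
def Walk.IsAlternating {G : RootedGraph.{u}} {n : ℕ} (w : G.Walk n) (c : G.E → Color) : Prop :=
  ∀ i j : Fin n, (j : ℕ) = i + 1 → c (w.edge i) ≠ c (w.edge j)

/-- The set `Dₙ(v)` of alternating d-walks of length `n` from `v` to `v`: alternating walks whose
first edge has color `1` and which are a pair `(u₁, u₂)` of f-walks from `v` to `v`. -/
def alternatingDWalks (G : RootedGraph.{u}) (c : G.E → Color) (v : G.V) (n : ℕ) :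
    Set (G.Walk n) :=
  {w | w.IsAlternating c ∧ (∀ i : Fin n, (i : ℕ) = 0 → c (w.edge i) = Color.one) ∧
    ∃ k, w.IsFSubwalk v 0 k ∧ w.IsFSubwalk v k (Fin.last n)}

end RootedGraph

/-! ### The free product of rooted graphs -/

section FreeProduct

variable (G : Color → RootedGraph.{u})

/-- The free product of the rooted vertex sets: words `x₁ x₂ ⋯ xₘ` (`m ≥ 0`) whose letters are
vertices other than the roots, with neighbouring letters from different graphs. The empty word
is the root. -/
def Word : Type u :=
  {w : List (Σ i, {x : (G i).V // x ≠ (G i).root}) // w.IsChain (fun a b => a.1 ≠ b.1)}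

/-- The words at which a copy of `G i` is attached by its root: those whose first letter is not
a vertex of `G i`. -/
def AttachingWord (i : Color) : Type u :=
  {u : Word G // ∀ a ∈ u.1.head?, a.1 ≠ i}

open Classical in
/-- The vertex `x u` of the free product that corresponds to the vertex `x` in the copy of `G i`
attached at `u`; the root of that copy is `u` itself. -/
noncomputable def place (i : Color) (u : AttachingWord G i) (x : (G i).V) : Word G :=
  if h : x = (G i).root then u.1
  else ⟨⟨i, x, h⟩ :: u.1.1, List.isChain_cons.2 ⟨fun a ha => (u.2 a ha).symm, u.1.2⟩⟩

/-- The free product `𝒢₁ * 𝒢₂` of rooted graphs: for every color `i` and every word `u` not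
beginning with a letter from `G i`, it contains a copy of `G i` with its root at `u`; an edge `β`
of `G i` with ends `x`, `y` gives an edge with ends `x u`, `y u`. -/
noncomputable def freeProduct : RootedGraph.{u} where
  V := Word G
  E := Σ i : Color, AttachingWord G i × (G i).E
  ends := fun β => ((G β.1).ends β.2.2).map (place G β.1 β.2.1)
  root := ⟨[], List.isChain_nil⟩

/-- The natural coloring: the edges of all copies of `G i` have color `i`. -/
def naturalColoring (β : (freeProduct G).E) : Color := β.1

/-- The adjacency operator `Sᵢ` of the subgraph of the free product formed by the edges of
color `i`. -/
noncomputable def monochromaticAdjacency (i : Color) :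
    ℓ²((freeProduct G).V, ℂ) →L[ℂ] ℓ²((freeProduct G).V, ℂ) :=
  ((freeProduct G).monochromatic (naturalColoring G) i).adjacencyOperator

end FreeProduct

end FreeMult

open FreeMult

universe u

/-! Two facts about the tree-like shape of the free product carry the theorem, one for freeness and
one for counting.

Freeness. For fixed i the copies of 𝒢ᵢ partition the vertices, and the edges of color i are those of
these copies. So Sᵢ is a direct sum of copies of A(𝒢ᵢ), one for each attaching word
(`colorStep_copyMap`). If w does not begin with a letter from Vᵢ, then p(Sᵢ)δ(w) is μᵢ(p)δ(w) plus a
combination of words xw with x ≠ eᵢ (`aeval_colorStep_single`). For w = e this shows that Sᵢ has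
distribution μᵢ. If μᵢ(p) = 0, every word that remains begins with a letter from Vᵢ. An alternating
product of centered factors applied to δ(e) therefore has no component along δ(e), which is
freeness. Uniqueness of the free product then gives Z = S₂S₁ the distribution μ₁ ⊠ μ₂, so the first
return moments agree.

Counting. φ_e(Zⁿ) counts the alternating walks of length 2n from e to e whose first edge has color 1
(`rootState_pow`). The root is a cut vertex: an f-walk from e whose first edge has color i stays
among the words whose last letter is from Vᵢ and can come back only along an edge of color i. An
alternating f-walk thus has odd length (`firstReturn_eq_zero`). Let a₀, a₁ be the generating series
of alternating f-walks that begin with color 1, 2, and v₀, v₁ those of alternating closed walks.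
Splitting at the first return gives v₀ = 1 + a₀v₁ and v₁ = 1 + a₁v₀, hence v₀ = 1 + a₀ + a₀a₁v₀.
Here a₀ has only odd exponents, and a₀a₁ has only even ones and counts d-walks. The even part is a
renewal equation for the moments of Z, whose coefficients are |D₂ₙ(e)| (`even_altVector_apply`).
Such an equation determines the first return moments (`firstReturnMoment_eq`). -/

namespace FreeMult

/-! ### Adjacency operators on finitely supported functions -/

namespace RootedGraph

/-- Every vertex is incident on finitely many edges. -/
def LocallyFinite (H : RootedGraph.{u}) : Prop :=
  ∀ x, {p : H.E × H.V | H.ends p.1 = s(x, p.2)}.Finite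

theorem UniformlyLocallyFinite.locallyFinite {H : RootedGraph.{u}}
    (hH : H.UniformlyLocallyFinite) : H.LocallyFinite := by
  obtain ⟨K, hK⟩ := hH
  intro x
  refine Set.Finite.of_finite_image (f := Prod.fst)
    ((Set.finite_of_encard_le_coe (hK x)).subset ?_) ?_
  · rintro _ ⟨p, hp, rfl⟩
    have hp : H.ends p.1 = s(x, p.2) := hp
    change x ∈ H.ends p.1
    rw [hp]
    exact Sym2.mem_mk_left _ _
  · rintro ⟨β, y⟩ hp ⟨β', y'⟩ hq h
    obtain rfl : β = β' := h
    have hp : H.ends β = s(x, y) := hp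
    have hq : H.ends β = s(x, y') := hq
    rw [Sym2.congr_right.1 (hp.symm.trans hq)]

open Classical in
/-- The pairs of an edge and a vertex by which a walk at `x` can be continued, subject to `R`. -/
noncomputable def LocallyFinite.steps {H : RootedGraph.{u}} (hH : H.LocallyFinite)
    (R : H.E → H.V → Prop) (x : H.V) : Finset (H.E × H.V) :=
  (hH x).toFinset.filter fun p => R p.1 p.2

theorem LocallyFinite.mem_steps {H : RootedGraph.{u}} (hH : H.LocallyFinite)
    {R : H.E → H.V → Prop} {x : H.V} {p : H.E × H.V} :
    p ∈ hH.steps R x ↔ H.ends p.1 = s(x, p.2) ∧ R p.1 p.2 := by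
  simp [steps]

/-- The algebraic adjacency operator which takes into account only the steps satisfying `R`. -/
noncomputable def LocallyFinite.stepOp {H : RootedGraph.{u}} (hH : H.LocallyFinite)
    (R : H.E → H.V → Prop) : Module.End ℂ (H.V →₀ ℂ) :=
  Finsupp.linearCombination ℂ fun x => ∑ p ∈ hH.steps R x, .single p.2 1

theorem LocallyFinite.stepOp_single {H : RootedGraph.{u}} (hH : H.LocallyFinite)
    (R : H.E → H.V → Prop) (x : H.V) :
    hH.stepOp R (.single x 1) = ∑ p ∈ hH.steps R x, .single p.2 1 := by
  simp [stepOp]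

theorem LocallyFinite.stepOp_single_apply {H : RootedGraph.{u}} (hH : H.LocallyFinite)
    (R : H.E → Prop) (x y : H.V) :
    hH.stepOp (fun β _ => R β) (.single x 1) y =
      (Nat.card {β : H.E // R β ∧ H.ends β = s(x, y)} : ℂ) := by
  classical
  rw [stepOp_single, Finsupp.finsetSum_apply]
  simp only [Finsupp.single_apply]
  rw [Finset.sum_boole, Nat.cast_inj]
  have h : ∀ β, β ∈ ((hH.steps (fun β _ => R β) x).filter fun p => p.2 = y).image Prod.fst ↔
      R β ∧ H.ends β = s(x, y) := by
    intro β
    simp [mem_steps, and_comm]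
  rw [Nat.subtype_card _ h, Finset.card_image_of_injOn]
  rintro ⟨β, z⟩ hp ⟨β', z'⟩ hq hβ
  obtain rfl : β = β' := hβ
  obtain rfl : z = y := (Finset.mem_filter.1 hp).2
  obtain rfl : z' = z := (Finset.mem_filter.1 hq).2
  rfl

/-- Finitely supported functions as elements of `ℓ²(V)`. -/
noncomputable def finsuppToLp (H : RootedGraph.{u}) : (H.V →₀ ℂ) →ₗ[ℂ] ℓ²(H.V, ℂ) :=
  Finsupp.linearCombination ℂ H.delta

theorem finsuppToLp_single (H : RootedGraph.{u}) (x : H.V) :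
    H.finsuppToLp (.single x 1) = H.delta x := by
  simp [finsuppToLp]

theorem finsuppToLp_apply (H : RootedGraph.{u}) (f : H.V →₀ ℂ) (x : H.V) :
    H.finsuppToLp f x = f x := by
  classical
  induction f using Finsupp.induction_linear with
  | zero => simp
  | add f g hf hg => simp [hf, hg]
  | single y c =>
    rw [← Finsupp.smul_single_one, map_smul, finsuppToLp_single]
    simp [delta, Finsupp.single_apply, Pi.single_apply, eq_comm]

/-- Local finiteness keeps supports finite, so linearity reduces the claim to basis vectors. All
moments at the root can then be computed in `H.V →₀ ℂ`, as finite sums without convergence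
questions. -/
theorem apply_finsuppToLp {H : RootedGraph.{u}} (hH : H.LocallyFinite)
    {T : ℓ²(H.V, ℂ) →L[ℂ] ℓ²(H.V, ℂ)} {R : H.E → Prop}
    (hT : ∀ x y, T (H.delta x) y = (Nat.card {β : H.E // R β ∧ H.ends β = s(x, y)} : ℂ))
    (f : H.V →₀ ℂ) : T (H.finsuppToLp f) = H.finsuppToLp (hH.stepOp (fun β _ => R β) f) := by
  induction f using Finsupp.induction_linear with
  | zero => simp
  | add f g hf hg => simp [hf, hg]
  | single y c =>
    rw [← Finsupp.smul_single_one]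
    simp only [map_smul]
    congr 1
    ext x
    rw [finsuppToLp_single, finsuppToLp_apply, hH.stepOp_single_apply, hT]

theorem aeval_apply_finsuppToLp {H : RootedGraph.{u}}
    {T : ℓ²(H.V, ℂ) →L[ℂ] ℓ²(H.V, ℂ)} {t : Module.End ℂ (H.V →₀ ℂ)}
    (hT : ∀ f, T (H.finsuppToLp f) = H.finsuppToLp (t f)) (p : Polynomial ℂ) (f : H.V →₀ ℂ) :
    Polynomial.aeval T p (H.finsuppToLp f) = H.finsuppToLp (Polynomial.aeval t p f) := by
  induction p using Polynomial.induction_on' generalizing f with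
  | add p q hp hq => simp [hp, hq]
  | monomial n a =>
    simp only [Polynomial.aeval_monomial, Algebra.algebraMap_eq_smul_one, smul_mul_assoc, one_mul,
      smul_apply, LinearMap.smul_apply, map_smul]
    congr 1
    induction n generalizing f with
    | zero => simp
    | succ n ih =>
      rw [pow_succ, pow_succ, mul_apply_eq_comp, hT, ih, Module.End.mul_apply]

theorem rootState_apply (H : RootedGraph.{u}) (T : ℓ²(H.V, ℂ) →L[ℂ] ℓ²(H.V, ℂ)) :
    H.rootState T = T (H.delta H.root) H.root :=
  H.inner_delta_left _ _

theorem rootState_aeval {H : RootedGraph.{u}}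
    {T : ℓ²(H.V, ℂ) →L[ℂ] ℓ²(H.V, ℂ)} {t : Module.End ℂ (H.V →₀ ℂ)}
    (hT : ∀ f, T (H.finsuppToLp f) = H.finsuppToLp (t f)) (p : Polynomial ℂ) :
    H.rootState (Polynomial.aeval T p) = Polynomial.aeval t p (.single H.root 1) H.root := by
  rw [rootState_apply, ← finsuppToLp_single, aeval_apply_finsuppToLp hT, finsuppToLp_apply]

theorem adjacencyOperator_finsuppToLp {H : RootedGraph.{u}} (hH : H.UniformlyLocallyFinite)
    (f : H.V →₀ ℂ) : H.adjacencyOperator (H.finsuppToLp f) =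
      H.finsuppToLp (hH.locallyFinite.stepOp (fun _ _ => True) f) := by
  refine apply_finsuppToLp hH.locallyFinite (fun x y => ?_) f
  rw [H.isAdjacencyOperator_adjacencyOperator hH]
  simp [edgeCount]

/-! ### Splitting the adjacency operator by color -/

theorem UniformlyLocallyFinite.monochromatic {H : RootedGraph.{u}} (hH : H.UniformlyLocallyFinite)
    (c : H.E → Color) (i : Color) : (H.monochromatic c i).UniformlyLocallyFinite := by
  obtain ⟨K, hK⟩ := hH
  refine ⟨K, fun x => le_trans ?_ (hK x)⟩
  have h : Function.Injective (Subtype.val : {β : H.E // c β = i} → H.E) :=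
    Subtype.val_injective
  refine (h.encard_image _).symm.le.trans (Set.encard_le_encard ?_)
  rintro _ ⟨β, hβ, rfl⟩
  exact hβ

theorem edgeCount_monochromatic (H : RootedGraph.{u}) (c : H.E → Color) (i : Color) (x y : H.V) :
    (H.monochromatic c i).edgeCount x y = Nat.card {β : H.E // c β = i ∧ H.ends β = s(x, y)} :=
  Nat.card_congr (Equiv.subtypeSubtypeEquivSubtypeInter (fun β => c β = i)
    (fun β => H.ends β = s(x, y)))

/-- The adjacency operator of the subgraph formed by the edges of color `i`. -/
noncomputable def colorAdjacency (H : RootedGraph.{u}) (c : H.E → Color) (i : Color) :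
    ℓ²(H.V, ℂ) →L[ℂ] ℓ²(H.V, ℂ) :=
  (H.monochromatic c i).adjacencyOperator

theorem colorAdjacency_delta_apply {H : RootedGraph.{u}} (hH : H.UniformlyLocallyFinite)
    (c : H.E → Color) (i : Color) (x y : H.V) :
    H.colorAdjacency c i (H.delta x) y =
      (Nat.card {β : H.E // c β = i ∧ H.ends β = s(x, y)} : ℂ) := by
  rw [← edgeCount_monochromatic]
  exact (H.monochromatic c i).isAdjacencyOperator_adjacencyOperator (hH.monochromatic c i) x y

theorem continuousLinearMap_ext {H : RootedGraph.{u}} {S T : ℓ²(H.V, ℂ) →L[ℂ] ℓ²(H.V, ℂ)}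
    (h : ∀ x, S (H.delta x) = T (H.delta x)) : S = T := by
  classical
  refine ContinuousLinearMap.ext fun f => ?_
  have hf := lp.hasSum_single (p := 2) (by norm_num) f
  have hs : ∀ x, lp.single 2 x (f x) = f x • H.delta x := by
    intro x
    rw [delta, ← lp.single_smul]
    simp
  refine (hf.mapL S).unique ?_
  convert hf.mapL T using 2 with x
  rw [hs, map_smul, map_smul, h]

theorem adjacencyOperator_eq_add {H : RootedGraph.{u}} (hH : H.UniformlyLocallyFinite)
    (c : H.E → Color) :
    H.adjacencyOperator = H.colorAdjacency c .one + H.colorAdjacency c .two := by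
  refine continuousLinearMap_ext fun x => ?_
  ext y
  rw [add_apply]
  change _ = (_ : ℂ) + _
  rw [H.isAdjacencyOperator_adjacencyOperator hH, colorAdjacency_delta_apply hH,
    colorAdjacency_delta_apply hH, edgeCount, ← Nat.cast_add, Nat.cast_inj]
  -- `Nat.card` of an infinite type is 0, so cardinalities of the two color classes add up only once
  -- finiteness is known.
  have hfin : Finite {β : H.E // H.ends β = s(x, y)} :=
    (((hH.locallyFinite x).image Prod.fst).subset fun β hβ => ⟨(β, y), hβ, rfl⟩).to_subtype
  have hfin' : ∀ i, Finite {β : H.E // c β = i ∧ H.ends β = s(x, y)} := fun i =>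
    Finite.of_injective (fun β => (⟨β.1, β.2.2⟩ : {β : H.E // H.ends β = s(x, y)}))
      fun a b h => Subtype.ext (congrArg (fun β => β.1) h)
  rw [← Nat.card_sum]
  classical
  refine Nat.card_congr ((Equiv.sumCompl fun β : {β : H.E // H.ends β = s(x, y)} =>
    c β.1 = .one).symm.trans (Equiv.sumCongr ?_ ?_))
  · exact (Equiv.subtypeSubtypeEquivSubtypeInter (fun β => H.ends β = s(x, y))
      fun β => c β = .one).trans (Equiv.subtypeEquivRight fun β => and_comm)
  · refine (Equiv.subtypeSubtypeEquivSubtypeInter (fun β => H.ends β = s(x, y))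
      fun β => ¬ c β = .one).trans (Equiv.subtypeEquivRight fun β => ?_)
    rcases h : c β <;> simp

/-! ### Counting walks -/

/-- Remove the last step of a walk. -/
def Walk.init {H : RootedGraph.{u}} {n : ℕ} (w : H.Walk (n + 1)) : H.Walk n where
  vert := fun i => w.vert i.castSucc
  edge := fun i => w.edge i.castSucc
  ends_edge := fun i => w.ends_edge i.castSucc

/-- Append a step to a walk. -/
def Walk.snoc {H : RootedGraph.{u}} {n : ℕ} (w : H.Walk n) (β : H.E) (y : H.V)
    (h : H.ends β = s(w.vert (Fin.last n), y)) : H.Walk (n + 1) where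
  vert := Fin.snoc (α := fun _ => H.V) w.vert y
  edge := Fin.snoc (α := fun _ => H.E) w.edge β
  ends_edge := fun i => by
    induction i using Fin.lastCases with
    | last => rw [Fin.snoc_last, Fin.succ_last, Fin.snoc_last, Fin.snoc_castSucc, h]
    | cast i => rw [Fin.snoc_castSucc, Fin.succ_castSucc, Fin.snoc_castSucc, Fin.snoc_castSucc,
        w.ends_edge]

theorem Walk.ext {H : RootedGraph.{u}} {n : ℕ} {w w' : H.Walk n} (hv : w.vert = w'.vert)
    (he : w.edge = w'.edge) : w = w' := by
  cases w; cases w'; subst hv; subst he; rfl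

theorem Walk.snoc_init {H : RootedGraph.{u}} {n : ℕ} (w : H.Walk (n + 1)) :
    w.init.snoc (w.edge (Fin.last n)) (w.vert (Fin.last (n + 1))) (w.ends_edge (Fin.last n)) =
      w :=
  Walk.ext (Fin.snoc_init_self (α := fun _ => H.V) w.vert)
    (Fin.snoc_init_self (α := fun _ => H.E) w.edge)

/-- The walks of length `n` from `x` whose `j`-th step satisfies `R j`. -/
def walksFrom (H : RootedGraph.{u}) (R : ℕ → H.E → H.V → Prop) (x : H.V) (n : ℕ) :
    Set (H.Walk n) :=
  {w | w.vert 0 = x ∧ ∀ j : Fin n, R j (w.edge j) (w.vert j.succ)}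

/-- The vector `∑ δ(v)`, where `v` runs over the end vertices of the walks from `x` whose steps
satisfy `R`. -/
noncomputable def LocallyFinite.walkVector {H : RootedGraph.{u}} (hH : H.LocallyFinite)
    (R : ℕ → H.E → H.V → Prop) (x : H.V) : ℕ → (H.V →₀ ℂ)
  | 0 => .single x 1
  | n + 1 => hH.stepOp (R n) (hH.walkVector R x n)

/-- A walk of length n + 1 is uniquely a walk of length n followed by an admissible step from its
last vertex, and `stepOp (R n)` replaces δ of that vertex by the sum over exactly these steps.
Induction gives finiteness and the sum over end vertices together. -/
theorem LocallyFinite.exists_walksFrom {H : RootedGraph.{u}} (hH : H.LocallyFinite)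
    (R : ℕ → H.E → H.V → Prop) (x : H.V) (n : ℕ) :
    ∃ F : Finset (H.Walk n), (∀ w, w ∈ F ↔ w ∈ H.walksFrom R x n) ∧
      ∑ w ∈ F, .single (w.vert (Fin.last n)) 1 = hH.walkVector R x n := by
  classical
  induction n with
  | zero =>
    refine ⟨{⟨fun _ => x, Fin.elim0, fun i => i.elim0⟩}, fun w => ?_, by simp [walkVector]⟩
    rw [Finset.mem_singleton]
    constructor
    · rintro rfl
      exact ⟨rfl, fun j => j.elim0⟩
    · rintro ⟨h, -⟩
      refine Walk.ext (funext fun i => ?_) (funext fun i => i.elim0)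
      obtain rfl := Fin.fin_one_eq_zero i
      rw [h]
  | succ n ih =>
    obtain ⟨F, hF, hsum⟩ := ih
    have hstep : ∀ (w : H.Walk n) (p : hH.steps (R n) (w.vert (Fin.last n))),
        H.ends p.1.1 = s(w.vert (Fin.last n), p.1.2) := fun w p => (hH.mem_steps.1 p.2).1
    let ext : (Σ w : H.Walk n, hH.steps (R n) (w.vert (Fin.last n))) → H.Walk (n + 1) :=
      fun q => q.1.snoc q.2.1.1 q.2.1.2 (hstep q.1 q.2)
    have hinit : ∀ q, (ext q).init = q.1 := fun q =>
      Walk.ext (Fin.init_snoc (α := fun _ => H.V) q.2.1.2 q.1.vert)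
        (Fin.init_snoc (α := fun _ => H.E) q.2.1.1 q.1.edge)
    have hlast : ∀ q, (ext q).vert (Fin.last (n + 1)) = q.2.1.2 := fun q =>
      Fin.snoc_last (α := fun _ => H.V) q.2.1.2 q.1.vert
    have hedge : ∀ q, (ext q).edge (Fin.last n) = q.2.1.1 := fun q =>
      Fin.snoc_last (α := fun _ => H.E) q.2.1.1 q.1.edge
    have hinj : Function.Injective ext := by
      intro q q' h
      have h1 : q.1 = q'.1 := by rw [← hinit q, ← hinit q', h]
      have h2 : q.2.1.2 = q'.2.1.2 := by rw [← hlast q, ← hlast q', h]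
      have h3 : q.2.1.1 = q'.2.1.1 := by rw [← hedge q, ← hedge q', h]
      obtain ⟨w, ⟨β, y⟩, hp⟩ := q
      obtain ⟨w', ⟨β', y'⟩, hp'⟩ := q'
      dsimp only at h1 h2 h3
      subst h1 h2 h3
      rfl
    refine ⟨(F.sigma fun w => Finset.univ).map ⟨ext, hinj⟩, fun w => ?_, ?_⟩
    · simp only [Finset.mem_map, Finset.mem_sigma, Finset.mem_univ, and_true,
        Function.Embedding.coeFn_mk, hF]
      constructor
      · rintro ⟨q, ⟨h0, hR⟩, rfl⟩
        refine ⟨?_, fun j => ?_⟩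
        · rw [← h0, ← hinit q]
          rfl
        · induction j using Fin.lastCases with
          | last =>
            rw [hedge, Fin.succ_last, hlast, Fin.val_last]
            exact (hH.mem_steps.1 q.2.2).2
          | cast j =>
            have := hR j
            rw [← hinit q] at this
            exact this
      · rintro ⟨h0, hR⟩
        refine ⟨⟨w.init, ⟨(w.edge (Fin.last n), w.vert (Fin.last (n + 1))),
          hH.mem_steps.2 ⟨w.ends_edge (Fin.last n), ?_⟩⟩⟩, ⟨h0, fun j => ?_⟩, w.snoc_init⟩
        · exact hR (Fin.last n)
        · exact hR j.castSucc
    · rw [Finset.sum_map, Finset.sum_sigma, walkVector, ← hsum, map_sum]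
      refine Finset.sum_congr rfl fun w _ => ?_
      rw [stepOp_single, ← Finset.sum_coe_sort (hH.steps _ _)]
      refine Finset.sum_congr rfl fun p _ => ?_
      change Finsupp.single ((ext ⟨w, p⟩).vert (Fin.last (n + 1))) (1 : ℂ) = _
      rw [hlast]

theorem LocallyFinite.finite_walksFrom {H : RootedGraph.{u}} (hH : H.LocallyFinite)
    (R : ℕ → H.E → H.V → Prop) (x : H.V) (n : ℕ) : (H.walksFrom R x n).Finite := by
  obtain ⟨F, hF, -⟩ := hH.exists_walksFrom R x n
  exact F.finite_toSet.subset fun w hw => (hF w).2 hw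

/-- If all the walks of a set described by `R` end at `y`, then their number is a coordinate of
the walk vector. -/
theorem LocallyFinite.ncard_walksFrom {H : RootedGraph.{u}} (hH : H.LocallyFinite)
    (R : ℕ → H.E → H.V → Prop) (x y : H.V) (n : ℕ)
    (hy : ∀ w ∈ H.walksFrom R x n, w.vert (Fin.last n) = y) :
    ((H.walksFrom R x n).ncard : ℂ) = hH.walkVector R x n y := by
  obtain ⟨F, hF, hsum⟩ := hH.exists_walksFrom R x n
  have : H.walksFrom R x n = F := Set.ext fun w => (hF w).symm
  rw [this, Set.ncard_coe_finset, ← hsum, Finsupp.finsetSum_apply,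
    Finset.sum_congr rfl fun w hw => by rw [hy w ((hF w).1 hw), Finsupp.single_eq_same]]
  simp

end RootedGraph

/-! ### Copies of the factors inside the free product -/

variable (G : Color → RootedGraph.{u})

theorem place_root (i : Color) (u : AttachingWord G i) : place G i u (G i).root = u.1 := by
  simp [place]

theorem place_val_of_ne (i : Color) (u : AttachingWord G i) {x : (G i).V} (h : x ≠ (G i).root) :
    (place G i u x).1 = ⟨i, x, h⟩ :: u.1.1 := by
  simp [place, h]

theorem exists_place_eq (i : Color) (w : Word G) : ∃ u x, place G i u x = w := by
  obtain ⟨l, hl⟩ := w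
  by_cases h : ∀ a ∈ l.head?, a.1 ≠ i
  · exact ⟨⟨⟨l, hl⟩, h⟩, (G i).root, place_root G i _⟩
  · rcases l with _ | ⟨⟨j, x, hx⟩, l⟩
    · simp at h
    · obtain rfl : j = i := by simpa using h
      refine ⟨⟨⟨l, hl.tail⟩, fun a ha => ?_⟩, x, ?_⟩
      · exact ((List.isChain_cons.1 hl).1 a ha).symm
      · exact Subtype.ext (place_val_of_ne G j _ hx)

/-- A vertex placed off the root begins with a letter from `G i`, while an attaching word does not,
so the two kinds never coincide. Together with `exists_place_eq`, the copies of `G i` partition the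
vertices. -/
theorem place_injective {i : Color} {u u' : AttachingWord G i} {x x' : (G i).V}
    (h : place G i u x = place G i u' x') : u = u' ∧ x = x' := by
  have hnot : ∀ (u u' : AttachingWord G i) (x' : (G i).V), x' ≠ (G i).root →
      u.1 ≠ place G i u' x' := by
    intro u u' x' hx' h
    have := u.2 ⟨i, x', hx'⟩ (by rw [h, place_val_of_ne G i u' hx']; simp)
    exact this rfl
  by_cases hx : x = (G i).root <;> by_cases hx' : x' = (G i).root
  · subst hx hx'
    rw [place_root, place_root] at h
    exact ⟨Subtype.ext h, rfl⟩
  · subst hx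
    rw [place_root] at h
    exact absurd h (hnot _ _ _ hx')
  · subst hx'
    rw [place_root] at h
    exact absurd h.symm (hnot _ _ _ hx)
  · have := congrArg Subtype.val h
    rw [place_val_of_ne G i u hx, place_val_of_ne G i u' hx'] at this
    simp only [List.cons.injEq, Sigma.mk.injEq, heq_eq_eq, Subtype.mk.injEq, true_and] at this
    exact ⟨Subtype.ext (Subtype.ext this.2), this.1⟩

/-- The letters of a vertex of the free product. -/
def letters {G : Color → RootedGraph.{u}} (w : (freeProduct G).V) :
    List (Σ i, {x : (G i).V // x ≠ (G i).root}) :=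
  (show Word G from w).1

/-- `place`, as a vertex of the free product. -/
noncomputable def copyVertex (i : Color) (u : AttachingWord G i) (x : (G i).V) :
    (freeProduct G).V :=
  place G i u x

/-- The words which do not begin with a letter from `G i`. -/
def noHeadVertices (i : Color) : Set (freeProduct G).V :=
  {w | ∀ a ∈ (letters w).head?, a.1 ≠ i}

theorem letters_root : letters (freeProduct G).root = [] := rfl

theorem root_mem_noHeadVertices (i : Color) : (freeProduct G).root ∈ noHeadVertices G i := by
  intro a ha
  rw [letters_root] at ha
  simp at ha

theorem letters_copyVertex_root (i : Color) (u : AttachingWord G i) :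
    letters (copyVertex G i u (G i).root) = u.1.1 :=
  congrArg Subtype.val (place_root G i u)

theorem letters_copyVertex_of_ne (i : Color) (u : AttachingWord G i) {x : (G i).V}
    (h : x ≠ (G i).root) : letters (copyVertex G i u x) = ⟨i, x, h⟩ :: u.1.1 :=
  place_val_of_ne G i u h

theorem exists_copyVertex_eq (i : Color) (w : (freeProduct G).V) :
    ∃ u x, copyVertex G i u x = w :=
  exists_place_eq G i w

theorem copyVertex_injective {i : Color} {u u' : AttachingWord G i} {x x' : (G i).V}
    (h : copyVertex G i u x = copyVertex G i u' x') : u = u' ∧ x = x' :=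
  place_injective G h

/-- Distinct copies of one factor are disjoint, so an edge of color `i` at a vertex of the copy at
`u` belongs to that copy. -/
theorem freeProduct_ends_eq_iff (i : Color) (u u' : AttachingWord G i) (β : (G i).E)
    (x : (G i).V) (w : (freeProduct G).V) :
    (freeProduct G).ends ⟨i, u', β⟩ = s(copyVertex G i u x, w) ↔
      u' = u ∧ ∃ y, w = copyVertex G i u y ∧ (G i).ends β = s(x, y) := by
  change ((G i).ends β).map (copyVertex G i u') = _ ↔ _
  generalize (G i).ends β = t
  induction t using Sym2.ind with
  | _ a b =>
    rw [Sym2.map_mk]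
    constructor
    · intro h
      rcases Sym2.eq_iff.1 h with ⟨h1, h2⟩ | ⟨h1, h2⟩
      · obtain ⟨rfl, rfl⟩ := copyVertex_injective G h1
        exact ⟨rfl, b, h2.symm, rfl⟩
      · obtain ⟨rfl, rfl⟩ := copyVertex_injective G h2
        exact ⟨rfl, a, h1.symm, Sym2.eq_swap⟩
    · rintro ⟨rfl, y, rfl, h⟩
      rw [← Sym2.map_mk, h, Sym2.map_mk]

theorem exists_copyVertex_of_ends_eq {β : (freeProduct G).E} {w w' : (freeProduct G).V}
    (h : (freeProduct G).ends β = s(w, w')) :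
    ∃ u x y, w = copyVertex G (naturalColoring G β) u x ∧
      w' = copyVertex G (naturalColoring G β) u y := by
  obtain ⟨i, u', β⟩ := β
  obtain ⟨u, x, rfl⟩ := exists_copyVertex_eq G i w
  obtain ⟨-, y, rfl, -⟩ := (freeProduct_ends_eq_iff G i u u' β x w').1 h
  exact ⟨u, x, y, rfl, rfl⟩

variable {G}

/-- Each word lies in one copy of each factor and meets only the edges of these two copies, so the
degree bounds add. -/
theorem uniformlyLocallyFinite_freeProduct (hG : ∀ i, (G i).UniformlyLocallyFinite) :
    (freeProduct G).UniformlyLocallyFinite := by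
  choose K hK using hG
  refine ⟨K .one + K .two, fun w => ?_⟩
  choose u x hx using fun i => exists_copyVertex_eq G i w
  let f : ∀ i, (G i).E → (freeProduct G).E := fun i β => ⟨i, u i, β⟩
  have hsub : {β | w ∈ (freeProduct G).ends β} ⊆
      f .one '' {β | x .one ∈ (G .one).ends β} ∪ f .two '' {β | x .two ∈ (G .two).ends β} := by
    rintro ⟨i, u', β⟩ hβ
    obtain ⟨w', hw'⟩ := Sym2.mem_iff_exists.1 hβ
    have h : (⟨i, u', β⟩ : (freeProduct G).E) ∈ f i '' {β | x i ∈ (G i).ends β} := by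
      rw [← hx i] at hw'
      obtain ⟨rfl, y, -, h⟩ := (freeProduct_ends_eq_iff G i (u i) u' β (x i) w').1 hw'
      exact ⟨β, Sym2.mem_iff_exists.2 ⟨y, h⟩, rfl⟩
    cases i
    · exact Or.inl h
    · exact Or.inr h
  calc (freeProduct G).degree w ≤ _ := Set.encard_le_encard hsub
    _ ≤ _ := Set.encard_union_le _ _
    _ ≤ (G .one).degree (x .one) + (G .two).degree (x .two) :=
      add_le_add (Set.encard_image_le _ _) (Set.encard_image_le _ _)
    _ ≤ _ := by
      rw [Nat.cast_add]
      exact add_le_add (hK _ _) (hK _ _)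

/-! ### The operators Sᵢ as direct sums, and their distributions -/

/-- The algebraic version of `monochromaticAdjacency`. -/
noncomputable def colorStep (hF : (freeProduct G).LocallyFinite) (i : Color) :
    Module.End ℂ ((freeProduct G).V →₀ ℂ) :=
  hF.stepOp fun β _ => naturalColoring G β = i

/-- The algebraic adjacency operator of `G i`. -/
noncomputable def factorStep (hG : ∀ i, (G i).UniformlyLocallyFinite) (i : Color) :
    Module.End ℂ ((G i).V →₀ ℂ) :=
  (hG i).locallyFinite.stepOp fun _ _ => True

/-- The inclusion of the copy of `G i` at `u` on the level of finitely supported functions. -/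
noncomputable def copyMap (i : Color) (u : AttachingWord G i) :
    ((G i).V →₀ ℂ) →ₗ[ℂ] ((freeProduct G).V →₀ ℂ) :=
  Finsupp.lmapDomain ℂ ℂ (copyVertex G i u)

theorem copyMap_single {i : Color} (u : AttachingWord G i) (x : (G i).V) (a : ℂ) :
    copyMap i u (.single x a) = .single (copyVertex G i u x) a :=
  Finsupp.mapDomain_single

theorem monochromaticAdjacency_finsuppToLp (hG : (freeProduct G).UniformlyLocallyFinite)
    (i : Color) (f : (freeProduct G).V →₀ ℂ) :
    monochromaticAdjacency G i ((freeProduct G).finsuppToLp f) =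
      (freeProduct G).finsuppToLp (colorStep hG.locallyFinite i f) :=
  RootedGraph.apply_finsuppToLp hG.locallyFinite
    (fun x y => RootedGraph.colorAdjacency_delta_apply hG _ i x y) f

/-- The steps of color `i` at a vertex of a copy of `G i` are in bijection with the steps at the
corresponding vertex of `G i` itself. -/
theorem colorStep_copyMap (hG : ∀ i, (G i).UniformlyLocallyFinite)
    (hF : (freeProduct G).LocallyFinite) (i : Color) (u : AttachingWord G i)
    (f : (G i).V →₀ ℂ) :
    colorStep hF i (copyMap i u f) = copyMap i u (factorStep hG i f) := by
  induction f using Finsupp.induction_linear with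
  | zero => simp
  | add f g hf hg => simp [hf, hg]
  | single x c =>
    rw [← Finsupp.smul_single_one]
    simp only [map_smul]
    congr 1
    rw [copyMap_single, colorStep, factorStep, RootedGraph.LocallyFinite.stepOp_single,
      RootedGraph.LocallyFinite.stepOp_single, map_sum]
    symm
    refine Finset.sum_bij (fun p _ => (⟨i, u, p.1⟩, copyVertex G i u p.2)) ?_ ?_ ?_ ?_
    · intro p hp
      rw [RootedGraph.LocallyFinite.mem_steps] at hp ⊢
      exact ⟨(freeProduct_ends_eq_iff G i u u p.1 x _).2 ⟨rfl, p.2, rfl, hp.1⟩, rfl⟩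
    · rintro ⟨β, y⟩ _ ⟨β', y'⟩ _ h
      have h1 := congrArg Prod.fst h
      have h3 := (copyVertex_injective G (congrArg Prod.snd h)).2
      exact Prod.ext (congrArg Prod.snd (eq_of_heq (Sigma.ext_iff.1 h1).2)) h3
    · rintro ⟨⟨j, u', β⟩, w⟩ hp
      rw [RootedGraph.LocallyFinite.mem_steps] at hp
      obtain ⟨h1, h2⟩ := hp
      obtain rfl : j = i := h2
      obtain ⟨rfl, y, rfl, h⟩ := (freeProduct_ends_eq_iff G j u u' β x w).1 h1
      exact ⟨(β, y), (hG j).locallyFinite.mem_steps.2 ⟨h, trivial⟩, rfl⟩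
    · intro p _
      rw [copyMap_single]

theorem aeval_colorStep_copyMap (hG : ∀ i, (G i).UniformlyLocallyFinite)
    (hF : (freeProduct G).LocallyFinite) (i : Color) (u : AttachingWord G i) (p : ℂ[X])
    (f : (G i).V →₀ ℂ) :
    Polynomial.aeval (colorStep hF i) p (copyMap i u f) =
      copyMap i u (Polynomial.aeval (factorStep hG i) p f) := by
  induction p using Polynomial.induction_on' generalizing f with
  | add p q hp hq => simp [hp, hq]
  | monomial n a =>
    simp only [Polynomial.aeval_monomial, Algebra.algebraMap_eq_smul_one, smul_mul_assoc, one_mul,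
      LinearMap.smul_apply, map_smul]
    congr 1
    induction n generalizing f with
    | zero => simp
    | succ n ih =>
      rw [pow_succ, pow_succ, Module.End.mul_apply, colorStep_copyMap hG, ih,
        Module.End.mul_apply]

theorem measureDistribution_spectralDistribution {H : RootedGraph.{u}} :
    measureDistribution H.spectralDistribution = H.rootState.distribution H.adjacencyOperator := by
  refine UnitalFunctional.ext fun p => ?_
  refine LinearMap.congr_fun (Module.Basis.ext (Polynomial.basisMonomials ℂ) fun n => ?_) p
  rw [measureDistribution, Module.Basis.constr_basis,
    ← (H.isSpectralDistribution_spectralDistribution n).2]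
  simp [UnitalFunctional.distribution]

theorem measureDistribution_apply (hG : ∀ i, (G i).UniformlyLocallyFinite) (i : Color)
    (p : ℂ[X]) : measureDistribution (G i).spectralDistribution p =
      Polynomial.aeval (factorStep hG i) p (.single (G i).root 1) (G i).root := by
  rw [measureDistribution_spectralDistribution]
  exact RootedGraph.rootState_aeval (RootedGraph.adjacencyOperator_finsuppToLp (hG i)) p

/-- The vector δ(w) is the root vector of the copy attached at `w`, where p(Sᵢ) acts as p(A(𝒢ᵢ)).
The coefficient at the root of the copy is μᵢ(p); each other vertex of the copy begins with a letter
from `G i`. -/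
theorem aeval_colorStep_single (hG : ∀ i, (G i).UniformlyLocallyFinite)
    (hF : (freeProduct G).LocallyFinite) {i : Color} {w : (freeProduct G).V}
    (hw : w ∈ noHeadVertices G i)
    (p : ℂ[X]) : ∃ f ∈ Finsupp.supported ℂ ℂ (noHeadVertices G i)ᶜ,
      Polynomial.aeval (colorStep hF i) p (.single w 1) =
        f + measureDistribution (G i).spectralDistribution p • .single w 1 := by
  let u : AttachingWord G i := ⟨w, hw⟩
  have hw1 : (Finsupp.single w 1 : (freeProduct G).V →₀ ℂ) =
      copyMap i u (.single (G i).root 1) := by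
    rw [copyMap_single]
    exact congrArg (fun v => Finsupp.single v (1 : ℂ)) (place_root G i u).symm
  set h := Polynomial.aeval (factorStep hG i) p (.single (G i).root 1) with hh
  refine ⟨copyMap i u (h.erase (G i).root), ?_, ?_⟩
  · classical
    rw [Finsupp.mem_supported]
    intro v hv
    have hv := Finsupp.mapDomain_support hv
    obtain ⟨x, hx, rfl⟩ := Finset.mem_image.1 hv
    have hx : x ≠ (G i).root := (Finset.mem_erase.1 (Finsupp.support_erase (f := h) ▸ hx)).1
    intro hmem
    exact hmem ⟨i, x, hx⟩ (by rw [letters_copyVertex_of_ne G i u hx]; simp) rfl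
  · rw [measureDistribution_apply hG, ← hh, hw1, aeval_colorStep_copyMap hG, ← hh, ← map_smul,
      ← map_add, Finsupp.smul_single_one, Finsupp.erase_add_single]

theorem rootState_aeval_monochromaticAdjacency (hG : ∀ i, (G i).UniformlyLocallyFinite)
    (i : Color) (p : ℂ[X]) :
    (freeProduct G).rootState (Polynomial.aeval (monochromaticAdjacency G i) p) =
      measureDistribution (G i).spectralDistribution p := by
  have hF := uniformlyLocallyFinite_freeProduct hG
  rw [RootedGraph.rootState_aeval (monochromaticAdjacency_finsuppToLp hF i)]
  have hmem := root_mem_noHeadVertices G i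
  obtain ⟨f, hf, h⟩ := aeval_colorStep_single hG hF.locallyFinite hmem p
  have h0 : f (freeProduct G).root = 0 := by
    by_contra h0
    exact hf (Finsupp.mem_support_iff.2 h0) hmem
  rw [h]
  simp [h0]

/-! ### Freeness of S₁ and S₂ -/

theorem aeval_colorStep_mem (hG : ∀ i, (G i).UniformlyLocallyFinite)
    (hF : (freeProduct G).LocallyFinite) {i : Color} {p : ℂ[X]}
    (hp : measureDistribution (G i).spectralDistribution p = 0) {f : (freeProduct G).V →₀ ℂ}
    (hf : f ∈ Finsupp.supported ℂ ℂ (noHeadVertices G i)) :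
    Polynomial.aeval (colorStep hF i) p f ∈ Finsupp.supported ℂ ℂ (noHeadVertices G i)ᶜ := by
  rw [Finsupp.supported_eq_span_single] at hf
  refine Submodule.span_induction ?_ (by simp) (fun x y _ _ hx hy => ?_)
    (fun c x _ hx => ?_) hf
  · rintro _ ⟨w, hw, rfl⟩
    obtain ⟨f, hf, h⟩ := aeval_colorStep_single hG hF hw p
    rw [h, hp, zero_smul, add_zero]
    exact hf
  · rw [map_add]; exact add_mem hx hy
  · rw [map_smul]; exact Submodule.smul_mem _ _ hx

/-- The rightmost factor acts first, hence induction from the tail. A centered factor of color j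
meets words without leading letter from `G j` and leaves only words with one; these have no leading
letter from the other graph, which is what the next factor needs. -/
theorem prod_apply_delta_root (hG : ∀ i, (G i).UniformlyLocallyFinite)
    (l : List (Color × (ℓ²((freeProduct G).V, ℂ) →L[ℂ] ℓ²((freeProduct G).V, ℂ))))
    (hc : l.IsChain (fun p q => p.1 ≠ q.1))
    (h : ∀ p ∈ l, p.2 ∈ Algebra.adjoin ℂ {monochromaticAdjacency G p.1} ∧
      (freeProduct G).rootState p.2 = 0) :
    ∃ f, (l.map Prod.snd).prod ((freeProduct G).delta (freeProduct G).root) =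
        (freeProduct G).finsuppToLp f ∧
      (∀ i, (l.map Prod.fst).head? ≠ some i → f ∈ Finsupp.supported ℂ ℂ (noHeadVertices G i)) ∧
      (l ≠ [] → f (freeProduct G).root = 0) := by
  have hroot := root_mem_noHeadVertices G
  induction l with
  | nil =>
    refine ⟨.single (freeProduct G).root 1, ?_, fun i _ => ?_, fun h => absurd rfl h⟩
    · rw [RootedGraph.finsuppToLp_single]
      simp
    · exact Finsupp.single_mem_supported ℂ _ (hroot i)
  | cons q l ih =>
    obtain ⟨j, T⟩ := q
    obtain ⟨f, hf, hsupp, -⟩ := ih hc.tail (fun p hp => h p (List.mem_cons_of_mem _ hp))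
    obtain ⟨hT, hT0⟩ := h (j, T) (by simp)
    rw [Algebra.adjoin_singleton_eq_range_aeval] at hT
    obtain ⟨p, hp⟩ := hT
    replace hp : Polynomial.aeval (monochromaticAdjacency G j) p = T := hp
    subst hp
    have hF := uniformlyLocallyFinite_freeProduct hG
    have hp0 : measureDistribution (G j).spectralDistribution p = 0 := by
      rw [← rootState_aeval_monochromaticAdjacency hG j p]; exact hT0
    have hj : (l.map Prod.fst).head? ≠ some j := by
      rcases l with _ | ⟨r, l⟩
      · simp
      · have := (List.isChain_cons_cons.1 hc).1
        simpa using this.symm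
    have hmem := aeval_colorStep_mem hG hF.locallyFinite hp0 (hsupp j hj)
    refine ⟨_, ?_, fun i hi => Finsupp.supported_mono ?_ hmem, fun _ => ?_⟩
    · rw [List.map_cons, List.prod_cons, mul_apply_eq_comp, hf]
      exact RootedGraph.aeval_apply_finsuppToLp (monochromaticAdjacency_finsuppToLp hF j) p f
    · have hji : j ≠ i := by simpa using hi
      intro w hw a ha hai
      refine hw fun b hb => ?_
      obtain rfl := Option.some.inj ((Option.mem_def.1 ha).symm.trans (Option.mem_def.1 hb))
      rw [hai]
      exact hji.symm
    · by_contra h0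
      exact hmem (Finsupp.mem_support_iff.2 h0) (hroot j)

theorem freelyIndependent_monochromaticAdjacency (hG : ∀ i, (G i).UniformlyLocallyFinite) :
    FreelyIndependent (freeProduct G).rootState
      fun i => Algebra.adjoin ℂ {monochromaticAdjacency G i} := by
  intro l hl hc h
  obtain ⟨f, hf, -, h0⟩ := prod_apply_delta_root hG l hc h
  rw [RootedGraph.rootState_apply, hf, RootedGraph.finsuppToLp_apply, h0 hl]

/-! ### Products of free random variables -/

theorem FreelyIndependent.mono {A : Type u} [Ring A] [Algebra ℂ A] {φ : UnitalFunctional A}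
    {B C : Color → Subalgebra ℂ A} (h : FreelyIndependent φ C) (hBC : ∀ i, B i ≤ C i) :
    FreelyIndependent φ B :=
  fun l hl hc hmem => h l hl hc fun p hp => ⟨hBC _ (hmem p hp).1, (hmem p hp).2⟩

theorem adjoin_sub_one_le {A : Type u} [Ring A] [Algebra ℂ A] (a : A) :
    Algebra.adjoin ℂ {a - 1} ≤ Algebra.adjoin ℂ {a} := by
  rw [Algebra.adjoin_le_iff, Set.singleton_subset_iff]
  exact sub_mem (Algebra.self_mem_adjoin_singleton ℂ a) (one_mem _)

/-- The pullback of a functional on a unital algebra along a unital homomorphism. -/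
def UnitalFunctional.comap {A : Type u} [Ring A] [Algebra ℂ A] {B : Type*} [Ring B] [Algebra ℂ B]
    (φ : UnitalFunctional A) (f : B →ₐ[ℂ] A) : UnitalFunctional B where
  toLinearMap := φ.toLinearMap ∘ₗ f.toLinearMap
  map_one' := by simpa using φ.map_one'

theorem UnitalFunctional.distribution_comap {A : Type u} [Ring A] [Algebra ℂ A] {B : Type*}
    [Ring B] [Algebra ℂ B] (φ : UnitalFunctional A) (f : B →ₐ[ℂ] A) (b : B) :
    (φ.comap f).distribution b = φ.distribution (f b) := by
  refine UnitalFunctional.ext fun p => ?_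
  change φ (f (Polynomial.aeval b p)) = φ (Polynomial.aeval (f b) p)
  rw [Polynomial.aeval_algHom_apply]

/-- The distribution of a product of two free random variables. -/
theorem FreelyIndependent.distribution_mul {A : Type u} [Ring A] [Algebra ℂ A]
    {φ : UnitalFunctional A} {a : Color → A}
    (h : FreelyIndependent φ fun i => Algebra.adjoin ℂ {a i}) :
    φ.distribution (a .two * a .one) =
      freeMulConv (φ.distribution (a .one)) (φ.distribution (a .two)) := by
  let f : FreeAlgebra ℂ Color →ₐ[ℂ] A := FreeAlgebra.lift ℂ a
  have hf : ∀ i, f (FreeAlgebra.ι ℂ i) = a i := fun i => FreeAlgebra.lift_ι_apply a i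
  let μ : Color → Distribution := fun
    | .one => φ.distribution (a .one)
    | .two => φ.distribution (a .two)
  -- Substituting `a i` for Xᵢ pulls φ back to ℂ⟨X₁, X₂⟩; uniqueness of the free product identifies
  -- the pullback with the functional that defines ⊠.
  have hfree : IsFreeProduct μ (φ.comap f) := by
    refine ⟨fun i => ?_, fun l hl hc hmem => ?_⟩
    · rw [UnitalFunctional.distribution_comap, hf]
      cases i <;> rfl
    · have := h (l.map fun p => (p.1, f p.2)) (by simpa using hl) ((List.isChain_map _).2 hc) ?_
      · rw [List.map_map] at this
        change φ (f _) = 0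
        rw [map_list_prod, List.map_map]
        exact this
      · intro p hp
        obtain ⟨q, hq, rfl⟩ := List.mem_map.1 hp
        refine ⟨?_, (hmem q hq).2⟩
        have := Subalgebra.mem_map.2 ⟨q.2, (hmem q hq).1, (rfl : f q.2 = f q.2)⟩
        rw [AlgHom.map_adjoin, Set.image_singleton, hf] at this
        exact this
  have heq : freeProductFunctional μ = φ.comap f :=
    (existsUnique_isFreeProduct μ).unique (isFreeProduct_freeProductFunctional μ) hfree
  change _ = (freeProductFunctional μ).distribution _
  rw [heq, UnitalFunctional.distribution_comap, map_mul, hf, hf]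

theorem distribution_monochromaticAdjacency (hG : ∀ i, (G i).UniformlyLocallyFinite) (i : Color) :
    (freeProduct G).rootState.distribution (monochromaticAdjacency G i) =
      measureDistribution (G i).spectralDistribution :=
  UnitalFunctional.ext fun p => rootState_aeval_monochromaticAdjacency hG i p

/-! ### First returns of alternating walks -/

/-- The alternating sequence of colors. -/
def altColor (n : ℕ) : Color := if Even n then .one else .two

theorem altColor_eq_iff {m n : ℕ} : altColor m = altColor n ↔ (Even m ↔ Even n) := by
  unfold altColor
  split_ifs <;> simp_all only [not_true, iff_self, iff_false, iff_true]

theorem altColor_congr {m n : ℕ} (h : Even m ↔ Even n) : altColor m = altColor n :=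
  altColor_eq_iff.2 h

namespace RootedGraph.LocallyFinite

variable {H : RootedGraph.{u}} (hH : H.LocallyFinite)

theorem stepOp_add (R P : H.E → H.V → Prop) (f : H.V →₀ ℂ) :
    hH.stepOp (fun β y => R β y ∧ P β y) f + hH.stepOp (fun β y => R β y ∧ ¬ P β y) f =
      hH.stepOp R f := by
  classical
  induction f using Finsupp.induction_linear with
  | zero => simp
  | add f g hf hg => rw [map_add, map_add, map_add, ← hf, ← hg]; abel
  | single x c =>
    rw [← Finsupp.smul_single_one]
    simp only [map_smul, stepOp_single]
    rw [← smul_add]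
    congr 1
    rw [← Finset.sum_filter_add_sum_filter_not (hH.steps R x) fun p => P p.1 p.2]
    congr 1 <;>
    · refine Finset.sum_congr (Finset.ext fun p => ?_) fun _ _ => rfl
      simp [mem_steps, and_assoc]

/-- Once all walks are forced to land at `z`, only their number is remembered; this is why counts
multiply under concatenation at `z`. -/
theorem stepOp_and_eq (R : H.E → H.V → Prop) (z : H.V) (f : H.V →₀ ℂ) :
    hH.stepOp (fun β y => R β y ∧ y = z) f = (hH.stepOp R f z) • .single z 1 := by
  classical
  induction f using Finsupp.induction_linear with
  | zero => simp
  | add f g hf hg => rw [map_add, map_add, hf, hg, Finsupp.add_apply, add_smul]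
  | single x c =>
    rw [← Finsupp.smul_single_one]
    simp only [map_smul, stepOp_single, Finsupp.smul_apply, smul_eq_mul, mul_smul]
    congr 1
    rw [Finsupp.finsetSum_apply, Finset.sum_smul]
    have h : hH.steps (fun β y => R β y ∧ y = z) x =
        (hH.steps R x).filter fun p => p.2 = z := by
      ext p
      simp [mem_steps, and_assoc]
    rw [h, Finset.sum_filter]
    refine Finset.sum_congr rfl fun p _ => ?_
    split_ifs with hp
    · rw [hp, Finsupp.single_eq_same, one_smul]
    · rw [Finsupp.single_apply, if_neg hp, zero_smul]

theorem stepOp_mem_supported {R : H.E → H.V → Prop} {s t : Set H.V}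
    (h : ∀ x ∈ s, ∀ β y, H.ends β = s(x, y) → R β y → y ∈ t) {f : H.V →₀ ℂ}
    (hf : f ∈ Finsupp.supported ℂ ℂ s) : hH.stepOp R f ∈ Finsupp.supported ℂ ℂ t := by
  rw [Finsupp.supported_eq_span_single] at hf
  refine Submodule.span_induction ?_ (by simp) (fun x y _ _ hx hy => ?_)
    (fun c x _ hx => ?_) hf
  · rintro _ ⟨x, hx, rfl⟩
    dsimp only
    rw [stepOp_single]
    refine sum_mem fun p hp => Finsupp.single_mem_supported ℂ _ ?_
    obtain ⟨h1, h2⟩ := hH.mem_steps.1 hp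
    exact h x hx p.1 p.2 h1 h2
  · rw [map_add]; exact add_mem hx hy
  · rw [map_smul]; exact Submodule.smul_mem _ _ hx

variable (c : H.E → Color) (z : H.V)

/-- The vector of the alternating walks from `z` whose colors begin with `altColor s`. -/
noncomputable def altVector (s n : ℕ) : H.V →₀ ℂ :=
  hH.walkVector (fun j β _ => c β = altColor (s + j)) z n

/-- The vector of the alternating walks from `z` that do not return to `z`. -/
noncomputable def avoidVector (s n : ℕ) : H.V →₀ ℂ :=
  hH.walkVector (fun j β y => c β = altColor (s + j) ∧ ¬ y = z) z n

/-- The number of alternating f-walks of length `n` from `z` to `z`. -/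
noncomputable def firstReturn (s : ℕ) : ℕ → ℂ
  | 0 => 0
  | n + 1 => hH.stepOp (fun β _ => c β = altColor (s + n)) (hH.avoidVector c z s n) z

theorem altVector_zero (s : ℕ) : hH.altVector c z s 0 = .single z 1 := rfl

theorem altVector_succ (s n : ℕ) : hH.altVector c z s (n + 1) =
    hH.stepOp (fun β _ => c β = altColor (s + n)) (hH.altVector c z s n) := rfl

theorem altVector_congr {s s' : ℕ} (h : Even s ↔ Even s') (n : ℕ) :
    hH.altVector c z s n = hH.altVector c z s' n := by
  have : ∀ j, altColor (s + j) = altColor (s' + j) := fun j =>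
    altColor_congr (by simp only [Nat.even_add, h])
  simp only [altVector, this]

theorem avoidVector_congr {s s' : ℕ} (h : Even s ↔ Even s') (n : ℕ) :
    hH.avoidVector c z s n = hH.avoidVector c z s' n := by
  have : ∀ j, altColor (s + j) = altColor (s' + j) := fun j =>
    altColor_congr (by simp only [Nat.even_add, h])
  simp only [avoidVector, this]

theorem firstReturn_congr {s s' : ℕ} (h : Even s ↔ Even s') (n : ℕ) :
    hH.firstReturn c z s n = hH.firstReturn c z s' n := by
  cases n with
  | zero => rfl
  | succ n =>
    rw [firstReturn, firstReturn, hH.avoidVector_congr c z h,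
      altColor_congr (by simp only [Nat.even_add, h] : Even (s + n) ↔ Even (s' + n))]

theorem stepOp_avoidVector (s n : ℕ) :
    hH.stepOp (fun β _ => c β = altColor (s + n)) (hH.avoidVector c z s n) =
      hH.firstReturn c z s (n + 1) • .single z 1 + hH.avoidVector c z s (n + 1) := by
  rw [← hH.stepOp_add _ (fun _ y => y = z), stepOp_and_eq]
  rfl

theorem avoidVector_mem_supported (s n : ℕ) :
    hH.avoidVector c z s (n + 1) ∈ Finsupp.supported ℂ ℂ {z}ᶜ := by
  refine hH.stepOp_mem_supported (s := Set.univ) (fun x _ β y _ hy => hy.2) ?_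
  simp

theorem avoidVector_apply (s n : ℕ) :
    hH.avoidVector c z s n z = if n = 0 then 1 else 0 := by
  cases n with
  | zero => simp [avoidVector, walkVector]
  | succ n =>
    rw [if_neg n.succ_ne_zero]
    by_contra h0
    exact hH.avoidVector_mem_supported c z s n (Finsupp.mem_support_iff.2 h0) rfl

/-- Decomposition of the alternating walks according to their first return. -/
theorem altVector_eq (s n : ℕ) : hH.altVector c z s n =
    ∑ k ∈ Finset.range (n + 1), hH.firstReturn c z s k • hH.altVector c z (s + k) (n - k) +
      hH.avoidVector c z s n := by
  induction n with
  -- The empty walk is counted by `avoidVector`; `firstReturn` is 0 at length 0.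
  | zero => simp [firstReturn, altVector, avoidVector, walkVector]
  | succ n ih =>
    rw [altVector_succ, ih, map_add, stepOp_avoidVector, Finset.sum_range_succ _ (n + 1),
      ← add_assoc, map_sum, Nat.sub_self, altVector_zero]
    congr 2
    refine Finset.sum_congr rfl fun k hk => ?_
    have hk : k ≤ n := Nat.lt_succ_iff.1 (Finset.mem_range.1 hk)
    -- A walk restarted at time k keeps the global color pattern, because its phase is shifted by k.
    rw [map_smul, Nat.succ_sub hk, altVector_succ, show s + k + (n - k) = s + n by omega]

theorem altVector_apply (s n : ℕ) : hH.altVector c z s n z =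
    (if n = 0 then 1 else 0) + ∑ p ∈ Finset.HasAntidiagonal.antidiagonal n,
      hH.firstReturn c z s p.1 * hH.altVector c z (s + p.1) p.2 z := by
  rw [altVector_eq, Finsupp.add_apply, avoidVector_apply, add_comm, Finsupp.finsetSum_apply,
    Finset.Nat.sum_antidiagonal_eq_sum_range_succ fun k l =>
      hH.firstReturn c z s k * hH.altVector c z (s + k) l z]
  rfl

/-! ### Counting alternating d-walks -/

/-- The condition on the steps of an alternating d-walk of length `n` which is at `z` at
time `k`. -/
def _root_.FreeMult.RootedGraph.dWalkStep {H : RootedGraph.{u}} (c : H.E → Color) (z : H.V)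
    (n k j : ℕ) (β : H.E) (y : H.V) : Prop :=
  c β = altColor j ∧ (y = z ↔ j + 1 = k ∨ j + 1 = n)

/-- With the next three lemmas this follows a d-walk in time: it avoids `z` before time k, collapses
to a multiple of δ(z) at k, avoids `z` again with color phase k, and returns at n. -/
theorem walkVector_dWalkStep_of_lt {n k : ℕ} (hkn : k ≤ n) {j : ℕ} (hj : j < k) :
    hH.walkVector (dWalkStep c z n k) z j = hH.avoidVector c z 0 j := by
  induction j with
  | zero => rfl
  | succ j ih =>
    rw [walkVector, ih (by omega)]
    have : dWalkStep c z n k j = fun β y => c β = altColor (0 + j) ∧ ¬ y = z := by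
      funext β y
      rw [dWalkStep, zero_add, eq_iff_iff]
      have h : ¬ (j + 1 = k ∨ j + 1 = n) := by omega
      simp [h]
    rw [this]
    rfl

theorem walkVector_dWalkStep_self {n k : ℕ} (hkn : k ≤ n) (hk : 0 < k) :
    hH.walkVector (dWalkStep c z n k) z k = hH.firstReturn c z 0 k • .single z 1 := by
  obtain ⟨j, rfl⟩ : ∃ j, k = j + 1 := ⟨k - 1, by omega⟩
  rw [walkVector, hH.walkVector_dWalkStep_of_lt c z hkn j.lt_succ_self, firstReturn,
    ← stepOp_and_eq]
  congr 2
  funext β y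
  simp [dWalkStep]

theorem walkVector_dWalkStep_add {n k : ℕ} (hk : 0 < k) {j : ℕ} (hj : k + j < n) :
    hH.walkVector (dWalkStep c z n k) z (k + j) =
      hH.firstReturn c z 0 k • hH.avoidVector c z k j := by
  induction j with
  | zero => exact hH.walkVector_dWalkStep_self c z (by omega) hk
  | succ j ih =>
    rw [← add_assoc, walkVector, ih (by omega), map_smul]
    congr 1
    rw [avoidVector, avoidVector, walkVector]
    congr 2
    funext β y
    rw [dWalkStep, eq_iff_iff]
    have h : ¬ (k + j + 1 = k ∨ k + j + 1 = n) := by omega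
    simp [h]

theorem walkVector_dWalkStep_apply {n k : ℕ} (hk : 0 < k) (hkn : k < n) :
    hH.walkVector (dWalkStep c z n k) z n z =
      hH.firstReturn c z 0 k * hH.firstReturn c z k (n - k) := by
  obtain ⟨j, rfl⟩ : ∃ j, n = k + j + 1 := ⟨n - k - 1, by omega⟩
  rw [walkVector, hH.walkVector_dWalkStep_add c z hk (by omega), map_smul,
    show k + j + 1 - k = j + 1 by omega, firstReturn]
  rw [Finsupp.smul_apply, smul_eq_mul]
  congr 1
  have : dWalkStep c z (k + j + 1) k (k + j) = fun β y => c β = altColor (k + j) ∧ y = z := by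
    funext β y
    simp [dWalkStep]
  rw [this, stepOp_and_eq]
  simp

/-- Two consecutive f-walks mean that the visits to `z` after time 0 occur exactly at some k
strictly between 0 and n, and at n. This turns a global condition into one on single steps, as
`walksFrom` requires. -/
theorem _root_.FreeMult.RootedGraph.alternatingDWalks_eq (H : RootedGraph.{u})
    (c : H.E → Color) (z : H.V) (n : ℕ) : H.alternatingDWalks c z n =
      ⋃ k ∈ Finset.Ioo 0 n, H.walksFrom (dWalkStep c z n k) z n := by
  ext w
  simp only [Set.mem_iUnion, Finset.mem_Ioo]
  constructor
  · rintro ⟨halt, hone, k, ⟨hk0, h0, hk, hint⟩, ⟨hkn, -, hn, hint'⟩⟩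
    -- With only two colors, alternation and the first color determine all the others.
    have hcol : ∀ (j : ℕ) (hj : j < n), c (w.edge ⟨j, hj⟩) = altColor j := by
      intro j
      induction j with
      | zero => exact fun hj => hone _ rfl
      | succ j ih =>
        intro hj
        have h1 := halt ⟨j, by omega⟩ ⟨j + 1, hj⟩ rfl
        rw [ih] at h1
        have h2 : altColor (j + 1) ≠ altColor j := by
          rw [Ne, altColor_eq_iff, Nat.even_add_one]
          tauto
        revert h1 h2
        rcases c (w.edge ⟨j + 1, hj⟩) <;> rcases altColor (j + 1) <;> rcases altColor j <;> simp
    refine ⟨k, ⟨hk0, hkn⟩, h0, fun j => ⟨hcol j j.2, fun h => ?_, fun h => ?_⟩⟩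
    · by_contra hne
      push Not at hne
      rcases lt_or_gt_of_ne hne.1 with hlt | hlt
      · exact hint j.succ (Fin.succ_pos j) (Fin.lt_def.2 hlt) h
      · refine hint' j.succ (Fin.lt_def.2 hlt) (Fin.lt_def.2 ?_) h
        have := j.2
        have := hne.2
        simp only [Fin.val_succ, Fin.val_last]
        omega
    · rcases h with h | h
      · rw [← hk]; congr 1; exact Fin.ext h
      · rw [← hn]; congr 1; exact Fin.ext h
  · rintro ⟨k, ⟨hk0, hkn⟩, h0, hR⟩
    have hv : ∀ i : Fin (n + 1), 0 < (i : ℕ) → (w.vert i = z ↔ (i : ℕ) = k ∨ (i : ℕ) = n) := by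
      intro i hi
      obtain ⟨j, rfl⟩ := Fin.exists_succ_eq.2 (Fin.pos_iff_ne_zero.1 hi)
      exact (hR j).2
    refine ⟨fun i j hij => ?_, fun i hi => ?_, ⟨k, by omega⟩, ⟨hk0, h0, ?_, ?_⟩,
      ⟨hkn, ?_, ?_, ?_⟩⟩
    · rw [(hR i).1, (hR j).1, Ne, altColor_eq_iff, hij, Nat.even_add_one]
      tauto
    · rw [(hR i).1, hi]
      simp [altColor]
    · exact (hv ⟨k, by omega⟩ hk0).2 (Or.inl rfl)
    · intro i hi hik h
      have hi' : 0 < (i : ℕ) := hi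
      have hik' : (i : ℕ) < k := hik
      rcases (hv i hi').1 h with h | h <;> omega
    · exact (hv ⟨k, by omega⟩ hk0).2 (Or.inl rfl)
    · exact (hv (Fin.last n) (by simp; omega)).2 (Or.inr rfl)
    · intro i hki hin h
      have hki' : k < (i : ℕ) := hki
      have hin' : (i : ℕ) < n := hin
      rcases (hv i (by omega)).1 h with h | h <;> omega

theorem finite_alternatingDWalks (hH : H.LocallyFinite) (n : ℕ) :
    (H.alternatingDWalks c z n).Finite := by
  rw [alternatingDWalks_eq]
  exact Set.Finite.biUnion (Finset.finite_toSet _) fun k _ => hH.finite_walksFrom _ _ _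

/-- The walk determines its splitting time k, so the pieces of `alternatingDWalks_eq` are disjoint.
The extra terms k = 0 and k = n of the antidiagonal vanish since `firstReturn` is 0 at length 0. -/
theorem ncard_alternatingDWalks (n : ℕ) : ((H.alternatingDWalks c z n).ncard : ℂ) =
    ∑ p ∈ Finset.HasAntidiagonal.antidiagonal n,
      hH.firstReturn c z 0 p.1 * hH.firstReturn c z p.1 p.2 := by
  classical
  let F : ℕ → Finset (H.Walk n) := fun k =>
    (hH.finite_walksFrom (dWalkStep c z n k) z n).toFinset
  have hmem : ∀ k w, w ∈ F k ↔ w ∈ H.walksFrom (dWalkStep c z n k) z n := by simp [F]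
  have hvert : ∀ k, ∀ w ∈ H.walksFrom (dWalkStep c z n k) z n, ∀ i : Fin (n + 1), 0 < (i : ℕ) →
      (w.vert i = z ↔ (i : ℕ) = k ∨ (i : ℕ) = n) := by
    intro k w hw i hi
    obtain ⟨j, rfl⟩ := Fin.exists_succ_eq.2 (Fin.pos_iff_ne_zero.1 hi)
    exact (hw.2 j).2
  have hU : H.alternatingDWalks c z n = ((Finset.Ioo 0 n).biUnion F : Finset (H.Walk n)) := by
    rw [alternatingDWalks_eq]
    ext w
    simp [hmem]
  rw [hU, Set.ncard_coe_finset, Finset.card_biUnion, Nat.cast_sum,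
    Finset.Nat.sum_antidiagonal_eq_sum_range_succ fun k l =>
      hH.firstReturn c z 0 k * hH.firstReturn c z k l]
  · have hsub : Finset.Ioo 0 n ⊆ Finset.range (n + 1) := fun k hk => by
      simp at hk ⊢; omega
    rw [← Finset.sum_subset hsub]
    · refine Finset.sum_congr rfl fun k hk => ?_
      obtain ⟨hk0, hkn⟩ := Finset.mem_Ioo.1 hk
      rw [← hH.walkVector_dWalkStep_apply c z hk0 hkn, ← hH.ncard_walksFrom,
        ← Set.ncard_coe_finset, Set.Finite.coe_toFinset]
      exact fun w hw => (hvert k w hw (Fin.last n) (by simp; omega)).2 (Or.inr rfl)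
    · intro k hk hk'
      have : k = 0 ∨ k = n := by simp at hk hk'; omega
      rcases this with rfl | rfl
      · simp [firstReturn]
      · simp [firstReturn]
  · intro k hk l hl hkl
    obtain ⟨hk0, hkn⟩ := Finset.mem_Ioo.1 hk
    obtain ⟨hl0, hln⟩ := Finset.mem_Ioo.1 hl
    rw [Function.onFun, Finset.disjoint_left]
    intro w hw hw'
    have h1 := (hvert k w ((hmem k w).1 hw) ⟨k, by omega⟩ hk0).2 (Or.inl rfl)
    rcases (hvert l w ((hmem l w).1 hw') ⟨k, by omega⟩ hk0).1 h1 with h | h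
    · exact hkl h
    · exact hkn.ne h

end RootedGraph.LocallyFinite

/-! ### Returns in the free product -/

variable {G : Color → RootedGraph.{u}}

/-- The nonempty words whose last letter comes from `G i`. -/
def branch (G : Color → RootedGraph.{u}) (i : Color) : Set (freeProduct G).V :=
  {w | ∃ a ∈ (letters w).getLast?, a.1 = i}

/-- New letters are put on the left, so xu has the same last letter as u, unless u is empty and x
itself is the last letter. -/
theorem copyVertex_mem_branch_iff {i j : Color} (u : AttachingWord G j) (x : (G j).V) :
    copyVertex G j u x ∈ branch G i ↔
      (∃ a ∈ u.1.1.getLast?, a.1 = i) ∨ (u.1.1 = [] ∧ x ≠ (G j).root ∧ j = i) := by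
  unfold branch
  rw [Set.mem_ofPred_eq]
  by_cases hx : x = (G j).root
  · subst hx
    rw [letters_copyVertex_root]
    simp
  · rw [letters_copyVertex_of_ne G j u hx]
    rcases h : u.1.1 with _ | ⟨b, l⟩
    · simp [hx]
    · simp [List.getLast?_cons_cons]

theorem copyVertex_eq_root_iff {j : Color} (u : AttachingWord G j) (x : (G j).V) :
    copyVertex G j u x = (freeProduct G).root ↔ u.1.1 = [] ∧ x = (G j).root := by
  constructor
  · intro h
    have h := congrArg letters h
    rw [letters_root] at h
    by_cases hx : x = (G j).root
    · subst hx
      rw [letters_copyVertex_root] at h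
      exact ⟨h, rfl⟩
    · rw [letters_copyVertex_of_ne G j u hx] at h
      simp at h
  · rintro ⟨hu, rfl⟩
    exact (place_root G j u).trans (Subtype.ext hu)

theorem mem_branch_of_root {β : (freeProduct G).E} {w : (freeProduct G).V}
    (h : (freeProduct G).ends β = s((freeProduct G).root, w)) (hw : w ≠ (freeProduct G).root) :
    w ∈ branch G (naturalColoring G β) := by
  obtain ⟨u, x, y, hx, rfl⟩ := exists_copyVertex_of_ends_eq G h
  obtain ⟨hu, -⟩ := (copyVertex_eq_root_iff u x).1 hx.symm
  rw [Ne, copyVertex_eq_root_iff] at hw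
  rw [copyVertex_mem_branch_iff]
  exact Or.inr ⟨hu, fun hy => hw ⟨hu, hy⟩, rfl⟩

/-- Both ends lie in one copy. If it is attached at a nonempty word, they share its last letter; if
it is attached at the root, all its other vertices are letters from one graph. So a branch can be
left only through the root. -/
theorem mem_branch_of_mem_branch {i : Color} {β : (freeProduct G).E} {w w' : (freeProduct G).V}
    (h : (freeProduct G).ends β = s(w, w')) (hw : w ∈ branch G i)
    (hw' : w' ≠ (freeProduct G).root) : w' ∈ branch G i := by
  obtain ⟨u, x, y, rfl, rfl⟩ := exists_copyVertex_of_ends_eq G h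
  rw [Ne, copyVertex_eq_root_iff] at hw'
  rw [copyVertex_mem_branch_iff] at hw ⊢
  rcases hw with hw | ⟨hu, -, hj⟩
  · exact Or.inl hw
  · exact Or.inr ⟨hu, fun hy => hw' ⟨hu, hy⟩, hj⟩

/-- Branch `i` touches the root only inside the copy of `G i` attached there, whose edges have color
`i`. -/
theorem ne_root_of_mem_branch {i : Color} {β : (freeProduct G).E} {w w' : (freeProduct G).V}
    (h : (freeProduct G).ends β = s(w, w')) (hw : w ∈ branch G i)
    (hβ : naturalColoring G β ≠ i) : w' ≠ (freeProduct G).root := by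
  obtain ⟨u, x, y, rfl, rfl⟩ := exists_copyVertex_of_ends_eq G h
  rw [Ne, copyVertex_eq_root_iff]
  rw [copyVertex_mem_branch_iff] at hw
  rintro ⟨hu, -⟩
  rcases hw with hw | ⟨-, -, hj⟩
  · rw [hu] at hw
    simp at hw
  · exact hβ hj

theorem avoidVector_mem_branch (hF : (freeProduct G).LocallyFinite) (s n : ℕ) :
    hF.avoidVector (naturalColoring G) (freeProduct G).root s (n + 1) ∈
      Finsupp.supported ℂ ℂ (branch G (altColor s)) := by
  induction n with
  | zero =>
    refine hF.stepOp_mem_supported (s := {(freeProduct G).root}) ?_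
      (Finsupp.single_mem_supported ℂ _ rfl)
    rintro x rfl β y h ⟨hβ, hy⟩
    change naturalColoring G β = altColor s at hβ
    rw [← hβ]
    exact mem_branch_of_root h hy
  | succ n ih =>
    refine hF.stepOp_mem_supported ?_ ih
    rintro x hx β y h ⟨-, hy⟩
    exact mem_branch_of_mem_branch h hx hy

/-- The first edge selects the branch of its own color, and the last edge must have that color too;
in an alternating walk of positive even length these two colors differ. -/
theorem firstReturn_eq_zero (hF : (freeProduct G).LocallyFinite) (s : ℕ) {n : ℕ} (hn : Even n) :
    hF.firstReturn (naturalColoring G) (freeProduct G).root s n = 0 := by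
  rcases n with _ | _ | n
  · rfl
  · simp at hn
  · have h := hF.stepOp_mem_supported (t := {(freeProduct G).root}ᶜ)
      (R := fun β _ => naturalColoring G β = altColor (s + (n + 1)))
      (fun x hx β y h hβ => ne_root_of_mem_branch h hx (by
        rw [hβ, Ne, altColor_eq_iff]
        simp only [Nat.even_add_one, Nat.even_add] at hn ⊢
        tauto)) (avoidVector_mem_branch hF s n)
    by_contra h0
    exact h (Finsupp.mem_support_iff.2 h0) rfl

/-! ### The renewal equation for the moments of Z -/

/-- A double series with even support in the first variable. -/
theorem sum_antidiagonal_two_mul {M : Type*} [AddCommMonoid M] (f : ℕ → ℕ → M)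
    (hf : ∀ p q, ¬ Even p → f p q = 0) (n : ℕ) :
    ∑ p ∈ Finset.HasAntidiagonal.antidiagonal (2 * n), f p.1 p.2 =
      ∑ p ∈ Finset.HasAntidiagonal.antidiagonal n, f (2 * p.1) (2 * p.2) := by
  symm
  refine Finset.sum_of_injOn (fun p => (2 * p.1, 2 * p.2)) ?_ ?_ ?_ fun _ _ => rfl
  · rintro ⟨a, b⟩ - ⟨a', b'⟩ - h
    simp only [Prod.mk.injEq] at h ⊢
    omega
  · rintro ⟨a, b⟩ h
    simp only [Finset.mem_coe,
      Finset.HasAntidiagonal.mem_antidiagonal] at h ⊢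
    omega
  · rintro ⟨a, b⟩ h h'
    refine hf a b fun ⟨k, hk⟩ => h' ⟨(k, n - k), ?_, ?_⟩
    · simp only [Finset.mem_coe, Finset.HasAntidiagonal.mem_antidiagonal] at h ⊢
      omega
    · simp only [Finset.HasAntidiagonal.mem_antidiagonal, Prod.mk.injEq] at h ⊢
      omega

/-- In the proof `a s` and `v s` are the generating series of first returns and of all returns with
color phase s. First returns have odd length, so each of them switches the phase, and the two
equations close up because `v 2 = v 0`. -/
theorem even_altVector_apply (hF : (freeProduct G).LocallyFinite) (n : ℕ) :
    hF.altVector (naturalColoring G) (freeProduct G).root 0 (2 * n) (freeProduct G).root =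
      (if n = 0 then 1 else 0) + ∑ p ∈ Finset.HasAntidiagonal.antidiagonal n,
        (((freeProduct G).alternatingDWalks (naturalColoring G) (freeProduct G).root
          (2 * p.1)).ncard : ℂ) *
        hF.altVector (naturalColoring G) (freeProduct G).root 0 (2 * p.2)
          (freeProduct G).root := by
  set c := naturalColoring G
  set e := (freeProduct G).root
  let a : ℕ → ℂ⟦X⟧ := fun s => PowerSeries.mk (hF.firstReturn c e s)
  let v : ℕ → ℂ⟦X⟧ := fun s => PowerSeries.mk fun n => hF.altVector c e s n e
  have hv : ∀ s, v s = 1 + a s * v (s + 1) := by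
    intro s
    ext n
    rw [map_add, PowerSeries.coeff_mul, PowerSeries.coeff_one, PowerSeries.coeff_mk,
      hF.altVector_apply]
    congr 1
    refine Finset.sum_congr rfl fun p _ => ?_
    rw [PowerSeries.coeff_mk, PowerSeries.coeff_mk]
    by_cases hp : Even p.1
    · rw [firstReturn_eq_zero hF s hp, zero_mul, zero_mul]
    · rw [hF.altVector_congr c e (s := s + p.1) (s' := s + 1)]
      simp [Nat.even_add, hp]
  have hv2 : v 2 = v 0 := by
    ext n
    rw [PowerSeries.coeff_mk, PowerSeries.coeff_mk, hF.altVector_congr c e (s := 2) (s' := 0)]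
    simp
  have hd : ∀ n, PowerSeries.coeff n (a 0 * a 1) =
      (((freeProduct G).alternatingDWalks c e n).ncard : ℂ) := by
    intro n
    rw [hF.ncard_alternatingDWalks, PowerSeries.coeff_mul]
    refine Finset.sum_congr rfl fun p _ => ?_
    rw [PowerSeries.coeff_mk, PowerSeries.coeff_mk]
    by_cases hp : Even p.1
    · rw [firstReturn_eq_zero hF 0 hp, zero_mul, zero_mul]
    · rw [hF.firstReturn_congr c e (s := p.1) (s' := 1)]
      simp [hp]
  have hodd : ∀ n, ¬ Even n → PowerSeries.coeff n (a 0 * a 1) = 0 := by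
    intro n hn
    rw [PowerSeries.coeff_mul]
    refine Finset.sum_eq_zero fun p hp => ?_
    rw [PowerSeries.coeff_mk, PowerSeries.coeff_mk]
    rw [← Finset.HasAntidiagonal.mem_antidiagonal.1 hp, Nat.even_add] at hn
    by_cases h1 : Even p.1
    · rw [firstReturn_eq_zero hF 0 h1, zero_mul]
    · rw [firstReturn_eq_zero hF 1 (n := p.2) (by tauto), mul_zero]
  have hmain : v 0 = 1 + a 0 + a 0 * a 1 * v 0 := by
    conv_lhs => rw [hv 0, hv 1, hv2]
    ring
  -- At an even exponent the term `a 0` drops out, and `a 0 * a 1` contributes only even exponents.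
  have h := congrArg (PowerSeries.coeff (2 * n)) hmain
  rw [map_add, map_add, PowerSeries.coeff_one, PowerSeries.coeff_mul, PowerSeries.coeff_mk,
    PowerSeries.coeff_mk, firstReturn_eq_zero hF 0 (even_two_mul n), add_zero,
    sum_antidiagonal_two_mul (fun p q => PowerSeries.coeff p (a 0 * a 1) *
      PowerSeries.coeff q (v 0)) (fun p q hp => by rw [hodd p hp, zero_mul])] at h
  simp only [hd, v, PowerSeries.coeff_mk, mul_eq_zero, OfNat.ofNat_ne_zero, false_or] at h
  exact h

/-- In S₂S₁ the factor S₁ acts first, so the powers of Z run through the colors 1, 2, 1, 2, …, the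
sequence `altColor` from index 0. -/
theorem rootState_pow (hG : (freeProduct G).UniformlyLocallyFinite) (n : ℕ) :
    (freeProduct G).rootState.distribution
        (monochromaticAdjacency G .two * monochromaticAdjacency G .one) (Polynomial.X ^ n) =
      hG.locallyFinite.altVector (naturalColoring G) (freeProduct G).root 0 (2 * n)
        (freeProduct G).root := by
  set hF := hG.locallyFinite
  have h1 := RootedGraph.rootState_aeval
    (T := monochromaticAdjacency G .two * monochromaticAdjacency G .one)
    (t := colorStep hF .two * colorStep hF .one) (fun f => by
      rw [mul_apply_eq_comp, monochromaticAdjacency_finsuppToLp hG,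
        monochromaticAdjacency_finsuppToLp hG, Module.End.mul_apply]) (Polynomial.X ^ n)
  refine h1.trans ?_
  rw [map_pow, Polynomial.aeval_X]
  congr 1
  clear h1
  induction n with
  | zero => rfl
  | succ n ih =>
    rw [pow_succ', Module.End.mul_apply, ih, Module.End.mul_apply, mul_add, mul_one,
      hF.altVector_succ _ _ _ (2 * n + 1), hF.altVector_succ]
    have e1 : altColor (0 + 2 * n) = .one := by simp [altColor]
    have e2 : altColor (0 + (2 * n + 1)) = .two := by simp [altColor]
    rw [e1, e2]
    rfl

/-- First return moments from a renewal equation for the moments. -/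
theorem firstReturnMoment_eq {μ : Distribution} {d : ℕ → ℂ}
    (h : ∀ n, μ (Polynomial.X ^ n) = (if n = 0 then 1 else 0) +
      ∑ p ∈ Finset.HasAntidiagonal.antidiagonal n, d p.1 * μ (Polynomial.X ^ p.2)) (n : ℕ) :
    firstReturnMoment μ n = d n := by
  have h1 : 1 + momentSeries μ = PowerSeries.mk fun n => μ (Polynomial.X ^ n) := by
    ext n
    rw [map_add, momentSeries, PowerSeries.coeff_mk, PowerSeries.coeff_mk, PowerSeries.coeff_one]
    by_cases hn : n = 0
    · subst hn
      simpa using μ.map_one'.symm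
    · simp [hn]
  have h2 : 1 + momentSeries μ = 1 + PowerSeries.mk d * (1 + momentSeries μ) := by
    rw [h1]
    ext n
    rw [map_add, PowerSeries.coeff_mk, PowerSeries.coeff_mul, PowerSeries.coeff_one, h n]
    simp only [PowerSeries.coeff_mk]
  have h3 : PowerSeries.constantCoeff (1 + momentSeries μ) ≠ 0 := by
    simp [momentSeries]
  -- The renewal equation reads ψ = d(1 + ψ), so ψ/(1 + ψ) = d.
  have h4 : etaSeries μ = PowerSeries.mk d * (1 + momentSeries μ) * (1 + momentSeries μ)⁻¹ :=
    congrArg (· * (1 + momentSeries μ)⁻¹) (add_left_cancel h2)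
  rw [firstReturnMoment, h4, mul_assoc, PowerSeries.mul_inv_cancel _ h3, mul_one,
    PowerSeries.coeff_mk]

end FreeMult

theorem theorem9p2 (G : Color → RootedGraph.{u}) (hG : ∀ i, (G i).UniformlyLocallyFinite) :
    (freeProduct G).UniformlyLocallyFinite ∧
    (freeProduct G).adjacencyOperator =
      monochromaticAdjacency G .one + monochromaticAdjacency G .two ∧
    FreelyIndependent (freeProduct G).rootState
      (fun i => Algebra.adjoin ℂ {monochromaticAdjacency G i - 1}) ∧
    ∀ n : ℕ, 1 ≤ n →
      firstReturnMoment ((freeProduct G).rootState.distribution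
          (monochromaticAdjacency G .two * monochromaticAdjacency G .one)) n =
        firstReturnMoment (freeMulConv (measureDistribution (G .one).spectralDistribution)
          (measureDistribution (G .two).spectralDistribution)) n ∧
      ((freeProduct G).alternatingDWalks (naturalColoring G) (freeProduct G).root (2 * n)).Finite ∧
      firstReturnMoment ((freeProduct G).rootState.distribution
          (monochromaticAdjacency G .two * monochromaticAdjacency G .one)) n =
        (((freeProduct G).alternatingDWalks (naturalColoring G) (freeProduct G).root
          (2 * n)).ncard : ℂ) := by
  have hF := uniformlyLocallyFinite_freeProduct hG
  -- `monochromaticAdjacency` unfolds to `colorAdjacency` of the natural coloring. Freeness passes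
  -- from the algebra of Sᵢ to that of Sᵢ − 1, which it contains.
  refine ⟨hF, RootedGraph.adjacencyOperator_eq_add hF (naturalColoring G),
    (freelyIndependent_monochromaticAdjacency hG).mono fun i => adjoin_sub_one_le _,
    fun n _ => ⟨?_, hF.locallyFinite.finite_alternatingDWalks _ _ _, ?_⟩⟩
  · rw [(freelyIndependent_monochromaticAdjacency hG).distribution_mul,
      distribution_monochromaticAdjacency hG, distribution_monochromaticAdjacency hG]
  · refine firstReturnMoment_eq (d := fun n => (((freeProduct G).alternatingDWalks
      (naturalColoring G) (freeProduct G).root (2 * n)).ncard : ℂ)) (fun n => ?_) n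
    simp only [rootState_pow hF]
    exact even_altVector_apply hF.locallyFinite n
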